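/- Let $b\in\mathbb{C}\setminus\{0\}$, $Q=b+b^{-1}$, $c=1+6Q^2$. Consider the algebra generated by $L_n$ and $a_n$ with $$[L_n,L_m]=(n-m)L_{n+m}+\tfrac{c}{12}(n^3-n)\delta_{n+m,0},\qquad [a_n,a_m]=\tfrac n2\,\delta_{n+m,0},\qquad [L_n,a_m]=0,$$ and for $P\in\mathbb{C}$ its highest weight module, the tensor product of the Virasoro Verma module and the Heisenberg Fock module, with vacuum $|P\rangle$: $L_n|P\rangle=a_n|P\rangle=0$ for $n>0$, $L_0|P\rangle=\Delta(P)|P\rangle$, $\Delta(P)=\tfrac{Q^2}{4}-P^2$. Conjugation is linear, reverses products, and is given by $L_n^+=L_{-n}$, $a_n^+=a_{-n}$; $\langle P|$ is the conjugate of $|P\rangle$. For a Young diagram $\lambda=(k_1\ge\dots\ge k_n)$ put $\hat L_{-\lambda}=L_{-k_n}\cdots L_{-k_1}$, $\hat L_{\lambda}=(\hat L_{-\lambda})^+=L_{k_1}\cdots L_{k_n}$, and define $\hat a_{-\lambda}$, $\hat a_{\lambda}$ in the same way; $|\lambda|$ is the number of boxes. For $\alpha\in\mathbb{C}$ let $V_\alpha=V_\alpha(1)$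 be the primary field $V_\alpha=\mathcal V_\alpha\cdot V^{\rm L}_\alpha$, where $\mathcal V_\alpha$ is the free exponential $e^{2(\alpha-Q)\varphi_-}e^{2\alpha\varphi_+}$ with $\varphi_+(z)=i\sum_{n>0}\frac{a_n}{n}z^{-n}$ and $\varphi_-(z)=i\sum_{n<0}\frac{a_n}{n}z^{-n}$, and $V^{\rm L}_\alpha(z)$ is the Virasoro primary field of dimension $\Delta(\alpha)=\alpha(Q-\alpha)$, that is, $[L_m,V^{\rm L}_\alpha(z)]=(z^{m+1}\partial_z+(m+1)\Delta(\alpha)z^m)V^{\rm L}_\alpha(z)$, with $\langle P'|V^{\rm L}_\alpha(z)|P\rangle=z^{P^2-P'^2-\Delta(\alpha)}$; in particular $\langle P'|V_\alpha|P\rangle=1$. Let $N\ge 1$, let $P\in\mathbb{C}$, and let $$Y_N=\sum_{|\sigma_1|+|\sigma_2|=N}C^{\sigma_1,\sigma_2}\,\hat a_{-\sigma_1}\hat L_{-\sigma_2}$$ be a level-$N$ element, where $\sigma_1,\sigma_2$ are Young diagrams and $C^{\sigma_1,\sigma_2}\in\mathbb{C}$. Suppose that $$\langle P'|\hat L_{\mu_1}\hat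 a_{\mu_2}\,V_\alpha\,Y_N|P\rangle=0$$ for all Young diagrams $\mu_1,\mu_2$ with $|\mu_1|+|\mu_2|<N$ and all $P',\alpha\in\mathbb{C}$. Then $Y_N=0$, that is, $C^{\sigma_1,\sigma_2}=0$ for all $\sigma_1,\sigma_2$. -/

import Mathlib

open scoped TensorProduct

noncomputable section

namespace VirHeis

/-! ### The Virasoro Verma module

The Verma module of highest weight `h` and central charge `c` is the free rank one module over
the enveloping algebra of the subalgebra spanned by `L_{-1}, L_{-2}, …`; its underlying space is
therefore that enveloping algebra, with `1` as highest weight vector. -/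

/-- The relations `[L_{-j-1}, L_{-k-1}] = (k - j) L_{-j-k-2}`; the generator with index `k : ℕ`
stands for `L_{-(k+1)}`. -/
inductive VirNegRel : FreeAlgebra ℂ ℕ → FreeAlgebra ℂ ℕ → Prop
  | comm (j k : ℕ) : VirNegRel
      (FreeAlgebra.ι ℂ j * FreeAlgebra.ι ℂ k)
      (FreeAlgebra.ι ℂ k * FreeAlgebra.ι ℂ j
        + ((k : ℂ) - (j : ℂ)) • FreeAlgebra.ι ℂ (j + k + 1))

/-- The enveloping algebra of the span of `L_{-1}, L_{-2}, …`, underlying every Verma module. -/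
def Verma : Type := RingQuot VirNegRel

instance : Ring Verma := inferInstanceAs (Ring (RingQuot VirNegRel))

instance : Algebra ℂ Verma := inferInstanceAs (Algebra ℂ (RingQuot VirNegRel))

/-- The quotient map from the free algebra. -/
def vermaMk : FreeAlgebra ℂ ℕ →ₐ[ℂ] Verma := RingQuot.mkAlgHom ℂ VirNegRel

lemma vermaMk_surjective : Function.Surjective vermaMk :=
  RingQuot.mkAlgHom_surjective ℂ VirNegRel

/-- `low k` is `L_{-(k+1)}`. -/
def low (k : ℕ) : Verma := vermaMk (FreeAlgebra.ι ℂ k)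

lemma low_mul_low (j k : ℕ) :
    low j * low k = low k * low j + ((k : ℂ) - (j : ℂ)) • low (j + k + 1) := by
  have h : vermaMk (FreeAlgebra.ι ℂ j * FreeAlgebra.ι ℂ k) =
      vermaMk (FreeAlgebra.ι ℂ k * FreeAlgebra.ι ℂ j
        + ((k : ℂ) - (j : ℂ)) • FreeAlgebra.ι ℂ (j + k + 1)) :=
    RingQuot.mkAlgHom_rel ℂ (VirNegRel.comm j k)
  simpa only [low, map_mul, map_add, map_smul] using h

/-- An algebra homomorphism out of the enveloping algebra, from operators satisfying the
relations. -/
def vermaLift {A : Type} [Ring A] [Algebra ℂ A] (f : ℕ → A)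
    (hf : ∀ j k : ℕ, f j * f k = f k * f j + ((k : ℂ) - (j : ℂ)) • f (j + k + 1)) :
    Verma →ₐ[ℂ] A :=
  RingQuot.liftAlgHom ℂ ⟨FreeAlgebra.lift ℂ f, by
    rintro _ _ ⟨j, k⟩
    simpa using hf j k⟩

lemma vermaLift_low {A : Type} [Ring A] [Algebra ℂ A] (f : ℕ → A)
    (hf : ∀ j k : ℕ, f j * f k = f k * f j + ((k : ℂ) - (j : ℂ)) • f (j + k + 1)) (k : ℕ) :
    vermaLift f hf (low k) = f k := by
  have h := RingQuot.liftAlgHom_mkAlgHom_apply (S := ℂ) (s := VirNegRel) (FreeAlgebra.lift ℂ f)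
    (by
      rintro _ _ ⟨j, k⟩
      simpa using hf j k) (FreeAlgebra.ι ℂ k)
  rw [FreeAlgebra.lift_ι_apply] at h
  exact h

/-- The central term of `[L_n, L_m]`. -/
def central (c : ℂ) (n m : ℤ) : ℂ := if n + m = 0 then c / 12 * ((n : ℂ) ^ 3 - n) else 0

/-- The Verma module is spanned by the monomials in the `L_{-k}` applied to the vacuum. -/
lemma verma_induction {p : Verma → Prop} (one : p 1) (add : ∀ v w, p v → p w → p (v + w))
    (smul : ∀ (r : ℂ) v, p v → p (r • v)) (mul : ∀ k v, p v → p (low k * v)) (v : Verma) :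
    p v := by
  have key : ∀ a : FreeAlgebra ℂ ℕ, ∀ v, p v → p (vermaMk a * v) := by
    intro a
    induction a using FreeAlgebra.induction with
    | grade0 r =>
      intro v hv
      have := smul r v hv
      rwa [AlgHom.commutes, ← Algebra.smul_def]
    | grade1 k => exact fun v hv => mul k v hv
    | mul a b ha hb =>
      intro v hv
      rw [map_mul, mul_assoc]
      exact ha _ (hb _ hv)
    | add a b ha hb =>
      intro v hv
      rw [map_add, add_mul]
      exact add _ _ (ha _ hv) (hb _ hv)
  obtain ⟨a, rfl⟩ := vermaMk_surjective v
  simpa using key a 1 one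

/-- If `x = v` and `y n = L_n v` for all `n`, then `stepL c k (x, y)` is the same data for
`L_{-(k+1)} v`, computed from
`L_n L_{-(k+1)} = L_{-(k+1)} L_n + (n+k+1) L_{n-k-1} + central term`. -/
def stepL (c : ℂ) (k : ℕ) : Module.End ℂ (Verma × (ℤ → Verma)) where
  toFun xy := (low k * xy.1, fun n => low k * xy.2 n
    + ((n : ℂ) + k + 1) • xy.2 (n - k - 1) + central c n (-(k + 1)) • xy.1)
  map_add' x y := by
    ext n
    · simp [mul_add]
    · simp only [Prod.snd_add, Pi.add_apply, Prod.fst_add, mul_add, smul_add]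
      abel
  map_smul' r x := by
    ext n
    · simp
    · simp only [Prod.smul_snd, Pi.smul_apply, Prod.smul_fst, mul_smul_comm, smul_add,
        RingHom.id_apply, smul_comm r]

lemma stepL_rel (c : ℂ) (j k : ℕ) :
    stepL c j * stepL c k
      = stepL c k * stepL c j + ((k : ℂ) - (j : ℂ)) • stepL c (j + k + 1) := by
  refine LinearMap.ext fun xy => Prod.ext ?_ (funext fun n => ?_)
  · simp only [Module.End.mul_apply, LinearMap.add_apply, LinearMap.smul_apply, stepL,
      LinearMap.coe_mk, AddHom.coe_mk, Prod.fst_add, Prod.smul_fst, ← mul_assoc]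
    rw [low_mul_low j k, add_mul, smul_mul_assoc]
  · simp only [Module.End.mul_apply, LinearMap.add_apply, LinearMap.smul_apply, stepL,
      LinearMap.coe_mk, AddHom.coe_mk, Prod.snd_add, Prod.smul_snd, Pi.add_apply, Pi.smul_apply,
      mul_add, mul_smul_comm, ← mul_assoc]
    rw [low_mul_low j k, add_mul, smul_mul_assoc]
    have e1 : n - (j : ℤ) - 1 - k - 1 = n - ((j + k + 1 : ℕ) : ℤ) - 1 := by push_cast; ring
    have e2 : n - (k : ℤ) - 1 - j - 1 = n - ((j + k + 1 : ℕ) : ℤ) - 1 := by push_cast; ring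
    rw [e1, e2]
    have hc : ((n : ℂ) + j + 1) * central c (n - j - 1) (-(k + 1))
        - ((n : ℂ) + k + 1) * central c (n - k - 1) (-(j + 1))
        = ((k : ℂ) - j) * central c n (-(((j + k + 1 : ℕ) : ℤ) + 1)) := by
      unfold central
      by_cases hn : n = j + k + 2
      · subst hn
        rw [if_pos (by ring), if_pos (by ring), if_pos (by push_cast; ring)]
        push_cast
        ring
      · rw [if_neg (by omega), if_neg (by omega), if_neg (by omega)]
        ring
    push_cast at hc ⊢
    generalize central c (n - j - 1) (-(k + 1)) = A at *
    generalize central c (n - k - 1) (-(j + 1)) = B at *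
    have hB : ((k : ℂ) - j) * central c n (-((j + k + 1 : ℤ) + 1))
      = ((n : ℂ) + j + 1) * A - ((n : ℂ) + k + 1) * B := by rw [hc]
    simp only [smul_add, smul_smul, hB]
    module

/-- The values `L_n |h⟩` on the highest weight vector. -/
def vacL (h : ℂ) : ℤ → Verma
  | Int.ofNat 0 => h • 1
  | Int.ofNat (_ + 1) => 0
  | Int.negSucc k => low k

/-- The operator `L_n` on the Verma module with central charge `c` and highest weight `h`. -/
def virL (c h : ℂ) (n : ℤ) : Module.End ℂ Verma :=
  LinearMap.proj n ∘ₗ LinearMap.snd ℂ Verma (ℤ → Verma)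
    ∘ₗ LinearMap.applyₗ ((1 : Verma), vacL h)
    ∘ₗ (vermaLift (stepL c) (stepL_rel c)).toLinearMap

lemma vacL_natCast (h : ℂ) (n : ℕ) : vacL h (n : ℤ) = (if n = 0 then h else 0) • 1 := by
  rcases n with _ | n
  · simp [vacL]
  · have : ((n + 1 : ℕ) : ℤ) = Int.ofNat (n + 1) := rfl
    rw [this]
    simp [vacL]

lemma virL_one (c h : ℂ) (n : ℤ) : virL c h n 1 = vacL h n := by
  simp [virL]

lemma stepL_fst (c h : ℂ) (v : Verma) :
    (vermaLift (stepL c) (stepL_rel c) v ((1 : Verma), vacL h)).1 = v := by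
  induction v using verma_induction with
  | one => simp
  | add v w hv hw => simp [hv, hw]
  | smul r v hv => simp [hv]
  | mul k v hv =>
    rw [map_mul, vermaLift_low, Module.End.mul_apply]
    simp [stepL, hv]

lemma virL_low_mul (c h : ℂ) (n : ℤ) (k : ℕ) (v : Verma) :
    virL c h n (low k * v) = low k * virL c h n v
      + ((n : ℂ) + k + 1) • virL c h (n - k - 1) v + central c n (-(k + 1)) • v := by
  have hf := stepL_fst c h v
  simp only [virL, LinearMap.comp_apply, AlgHom.toLinearMap_apply, map_mul, vermaLift_low,
    LinearMap.applyₗ_apply_apply, Module.End.mul_apply]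
  generalize vermaLift (stepL c) (stepL_rel c) v ((1 : Verma), vacL h) = xy at *
  subst hf
  rfl

/-- Negative modes act by left multiplication. -/
lemma virL_negSucc (c h : ℂ) (k : ℕ) (v : Verma) : virL c h (Int.negSucc k) v = low k * v := by
  induction v using verma_induction generalizing k with
  | one => simp [virL_one, vacL]
  | add v w hv hw => simp [hv, hw, mul_add]
  | smul r v hv => simp [hv]
  | mul j v hv =>
    have e : Int.negSucc k - (j : ℤ) - 1 = Int.negSucc (k + j + 1) := by omega
    rw [virL_low_mul, hv k, e, hv (k + j + 1), ← mul_assoc, ← mul_assoc, low_mul_low k j,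
      add_mul, smul_mul_assoc]
    have : central c (Int.negSucc k) (-(j + 1)) = 0 := by
      unfold central
      rw [if_neg (by omega)]
    rw [this, zero_smul, add_zero, Int.cast_negSucc]
    congr 2
    push_cast
    ring

lemma central_swap (c : ℂ) (n m : ℤ) : central c m n = - central c n m := by
  unfold central
  by_cases h : n + m = 0
  · obtain rfl : m = -n := by omega
    simp
    ring
  · rw [if_neg h, if_neg (by omega)]
    simp

lemma central_jacobi (c : ℂ) (n m p : ℤ) :
    ((m : ℂ) - p) * central c n (m + p) - ((n : ℂ) - p) * central c m (n + p)
      = ((n : ℂ) - m) * central c (n + m) p := by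
  unfold central
  by_cases h : n + m + p = 0
  · obtain rfl : p = -n - m := by omega
    rw [if_pos (by ring), if_pos (by ring), if_pos (by ring)]
    push_cast
    ring
  · rw [if_neg (by omega), if_neg (by omega), if_neg (by omega)]
    ring

/-- The Virasoro commutation relations. -/
theorem virL_comm (c h : ℂ) (n m : ℤ) (v : Verma) :
    virL c h n (virL c h m v) - virL c h m (virL c h n v)
      = ((n : ℂ) - m) • virL c h (n + m) v + central c n m • v := by
  have hneg : ∀ (n : ℤ) (k : ℕ) (v : Verma),
      virL c h n (virL c h (Int.negSucc k) v) - virL c h (Int.negSucc k) (virL c h n v)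
      = ((n : ℂ) - (Int.negSucc k : ℤ)) • virL c h (n + Int.negSucc k) v
        + central c n (Int.negSucc k) • v := by
    intro n k v
    have e : Int.negSucc k = -((k : ℤ) + 1) := by omega
    have e' : n - (k : ℤ) - 1 = n + Int.negSucc k := by omega
    rw [virL_negSucc, virL_negSucc, virL_low_mul, e', Int.cast_negSucc, ← e]
    push_cast
    module
  induction v using verma_induction generalizing n m with
  | one =>
    rcases m with m | m
    · rcases n with n | n
      · simp only [Int.ofNat_eq_natCast, virL_one, vacL_natCast, map_smul, ← Nat.cast_add]
        rcases Nat.eq_zero_or_pos n with rfl | hn <;> rcases Nat.eq_zero_or_pos m with rfl | hm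
        · simp [central]
        · simp [central, hm.ne']
        · simp [central, hn.ne']
        · have : n + m ≠ 0 := by omega
          simp [central, hn.ne']
          omega
      · have := hneg (Int.ofNat m) n 1
        rw [central_swap, ← neg_sub, this, add_comm (Int.negSucc n)]
        module
    · exact hneg n m 1
  | add v w hv hw =>
    simp only [map_add, smul_add]
    rw [add_sub_add_comm, hv, hw]
    abel
  | smul r v hv =>
    simp only [map_smul]
    rw [← smul_sub, hv]
    module
  | mul k v hv =>
    have h1 := congrArg (low k * ·) (hv n m)
    have h2 := hv (n - k - 1) m
    have h3 := hv n (m - k - 1)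
    have hc := central_jacobi c n m (-(k + 1))
    rw [central_swap c (n + -(k + 1))] at hc
    have e1 : n + -((k : ℤ) + 1) = n - k - 1 := by ring
    have e2 : m + -((k : ℤ) + 1) = m - k - 1 := by ring
    have e3 : n - (k : ℤ) - 1 + m = n + m - k - 1 := by ring
    have e4 : n + (m - (k : ℤ) - 1) = n + m - k - 1 := by ring
    rw [e1, e2] at hc
    rw [e3] at h2
    rw [e4] at h3
    simp only [mul_sub, mul_add, mul_smul_comm] at h1
    simp only [virL_low_mul, map_add, map_smul]
    push_cast at h1 h2 h3 hc ⊢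
    rw [sub_eq_iff_eq_add] at h1 h2 h3
    rw [h1, h2, h3]
    have hc' : ((n : ℂ) - m) * central c (n + m) (-(k + 1))
      = ((m : ℂ) - (-1 + -(k : ℂ))) * central c n (m - k - 1)
        + ((n : ℂ) - (-1 + -(k : ℂ))) * central c (n - k - 1) m := by
      rw [← sub_eq_zero] at hc ⊢
      linear_combination -hc
    simp only [smul_add, smul_smul, hc']
    module

/-! ### The Virasoro primary field -/

/-- The operator `L_n` on the (completed) space of out-states, realised as the full dual of the
Verma module through the conjugation `L_n⁺ = L_{-n}`. -/
def virOut (c h : ℂ) (n : ℤ) : Module.End ℂ (Module.Dual ℂ Verma) := (virL c h (-n)).dualMap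

lemma virOut_comm (c h : ℂ) (n m : ℤ) (φ : Module.Dual ℂ Verma) :
    virOut c h n (virOut c h m φ) - virOut c h m (virOut c h n φ)
      = ((n : ℂ) - m) • virOut c h (n + m) φ + central c n m • φ := by
  refine LinearMap.ext fun u => ?_
  have e := congrArg φ (virL_comm c h (-m) (-n) u)
  have h1 : central c (-m) (-n) = central c n m := by
    unfold central
    by_cases h : n + m = 0
    · obtain rfl : m = -n := by omega
      simp
    · rw [if_neg h, if_neg (by omega)]
  have h2 : -m + -n = -(n + m) := by ring
  rw [h1, h2] at e
  simp only [map_sub, map_add, map_smul] at e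
  push_cast at e
  simp only [virOut, LinearMap.sub_apply, LinearMap.add_apply, LinearMap.smul_apply,
    LinearMap.dualMap_apply, e]
  module

section Extend

variable {R : Type} [AddCommGroup R] [Module ℂ R]

/-- On a family `f` of vectors indexed by levels, raise the level by `k + 1` and apply
`D k + (k + 1) δ + n` to the level `n` component. -/
def levelStep (δ : ℂ) (D : ℕ → Module.End ℂ R) (k : ℕ) : Module.End ℂ (ℕ →₀ R) :=
  Finsupp.lsum ℂ fun n =>
    Finsupp.lsingle (n + k + 1) ∘ₗ (D k + (((k : ℂ) + 1) * δ + n) • LinearMap.id)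

/-- The condition on the operators `D k` under which `levelStep` respects the relations of the
Verma module. -/
def LevelRel (D : ℕ → Module.End ℂ R) : Prop :=
  ∀ (j k : ℕ) (r : R), D j (D k r) = D k (D j r) + ((j : ℂ) + 1) • D j r
    - ((k : ℂ) + 1) • D k r + ((k : ℂ) - j) • D (j + k + 1) r

lemma levelStep_single (δ : ℂ) (D : ℕ → Module.End ℂ R) (k n : ℕ) (r : R) :
    levelStep δ D k (Finsupp.single n r)
      = Finsupp.single (n + k + 1) (D k r + (((k : ℂ) + 1) * δ + n) • r) := by
  simp [levelStep]

lemma levelStep_rel (δ : ℂ) {D : ℕ → Module.End ℂ R} (hD : LevelRel D) (j k : ℕ) :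
    levelStep δ D j * levelStep δ D k = levelStep δ D k * levelStep δ D j
      + ((k : ℂ) - (j : ℂ)) • levelStep δ D (j + k + 1) := by
  refine Finsupp.lhom_ext fun n r => ?_
  simp only [Module.End.mul_apply, LinearMap.add_apply, LinearMap.smul_apply, levelStep_single]
  have e1 : n + k + 1 + j + 1 = n + j + k + 2 := by ring
  have e2 : n + j + 1 + k + 1 = n + j + k + 2 := by ring
  have e3 : n + (j + k + 1) + 1 = n + j + k + 2 := by ring
  rw [e1, e2, e3, Finsupp.smul_single, ← Finsupp.single_add]
  congr 1
  simp only [map_add, map_smul, hD j k r]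
  push_cast
  module

/-- The linear map `F` from the Verma module to `R` with `F 1 = r` and
`F (L_{-(k+1)} v) = (D k + (k + 1) δ + n) (F v)` for `v` of level `n`. -/
def levelExtend (δ : ℂ) {D : ℕ → Module.End ℂ R} (hD : LevelRel D) (r : R) : Verma →ₗ[ℂ] R :=
  (Finsupp.lsum ℂ fun _ => LinearMap.id)
    ∘ₗ LinearMap.applyₗ (Finsupp.single 0 r)
    ∘ₗ (vermaLift (levelStep δ D) (levelStep_rel δ hD)).toLinearMap

lemma levelExtend_one (δ : ℂ) {D : ℕ → Module.End ℂ R} (hD : LevelRel D) (r : R) :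
    levelExtend δ hD r 1 = r := by
  simp [levelExtend]

lemma levelExtend_low_mul (δ : ℂ) {D : ℕ → Module.End ℂ R} (hD : LevelRel D) (r : R)
    (c h : ℂ) (k : ℕ) (v : Verma) :
    levelExtend δ hD r (low k * v) = D k (levelExtend δ hD r v)
      + (((k : ℂ) + 1) * δ - h) • levelExtend δ hD r v
      + levelExtend δ hD r (virL c h 0 v) := by
  set ρ := vermaLift (levelStep δ D) (levelStep_rel δ hD) with hρ
  let wt : Module.End ℂ (ℕ →₀ R) :=
    Finsupp.lsum ℂ fun n => Finsupp.lsingle n ∘ₗ ((h + n) • LinearMap.id)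
  have hw : ∀ k f, wt (levelStep δ D k f)
      = levelStep δ D k (wt f) + ((k : ℂ) + 1) • levelStep δ D k f := by
    intro k f
    suffices wt ∘ₗ levelStep δ D k
        = levelStep δ D k ∘ₗ wt + ((k : ℂ) + 1) • levelStep δ D k from
      LinearMap.congr_fun this f
    refine Finsupp.lhom_ext fun n r => ?_
    simp only [LinearMap.comp_apply, LinearMap.add_apply, LinearMap.smul_apply, levelStep_single,
      wt, Finsupp.lsum_single, Finsupp.lsingle_apply, LinearMap.id_apply, Finsupp.smul_single,
      ← Finsupp.single_add]
    congr 1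
    simp only [map_smul]
    push_cast
    module
  have key : ∀ v, ρ (virL c h 0 v) (Finsupp.single 0 r) = wt (ρ v (Finsupp.single 0 r)) := by
    intro v
    induction v using verma_induction with
    | one =>
      have : virL c h 0 1 = h • 1 := virL_one c h 0
      rw [this]
      simp [wt]
    | add v w hv hw => simp [hv, hw]
    | smul r v hv => simp [hv]
    | mul k v hv =>
      have e : (0 : ℤ) - k - 1 = Int.negSucc k := by omega
      have e' : central c 0 (-((k : ℤ) + 1)) = 0 := by
        unfold central
        rw [if_neg (by omega)]
      rw [virL_low_mul, e, virL_negSucc, e', zero_smul, add_zero]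
      simp only [map_add, map_mul, map_smul, LinearMap.add_apply, LinearMap.smul_apply,
        Module.End.mul_apply, hv]
      rw [hρ, vermaLift_low, hw]
      push_cast
      module
  have sum_step : ∀ f : ℕ →₀ R,
      (Finsupp.lsum ℂ fun _ => (LinearMap.id : R →ₗ[ℂ] R)) (levelStep δ D k f)
      = D k ((Finsupp.lsum ℂ fun _ => (LinearMap.id : R →ₗ[ℂ] R)) f)
        + (((k : ℂ) + 1) * δ - h) • (Finsupp.lsum ℂ fun _ => (LinearMap.id : R →ₗ[ℂ] R)) f
        + (Finsupp.lsum ℂ fun _ => (LinearMap.id : R →ₗ[ℂ] R)) (wt f) := by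
    intro f
    let S : (ℕ →₀ R) →ₗ[ℂ] R := Finsupp.lsum ℂ fun _ => (LinearMap.id : R →ₗ[ℂ] R)
    suffices S ∘ₗ levelStep δ D k
        = D k ∘ₗ S + (((k : ℂ) + 1) * δ - h) • S + S ∘ₗ wt from LinearMap.congr_fun this f
    refine Finsupp.lhom_ext fun n r => ?_
    simp only [LinearMap.comp_apply, LinearMap.add_apply, LinearMap.smul_apply, levelStep_single,
      S, wt, Finsupp.lsum_single, Finsupp.lsingle_apply, LinearMap.id_apply]
    module
  simp only [levelExtend, LinearMap.comp_apply, AlgHom.toLinearMap_apply,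
    LinearMap.applyₗ_apply_apply, ← hρ, key]
  rw [map_mul, Module.End.mul_apply, ← sum_step, hρ, vermaLift_low]

end Extend

lemma levelRel_scalar (t : ℂ) : LevelRel (fun _ : ℕ => t • (LinearMap.id : ℂ →ₗ[ℂ] ℂ)) := by
  intro j k r
  simp only [LinearMap.smul_apply, LinearMap.id_apply, smul_eq_mul]
  ring

lemma levelRel_out (c h h' : ℂ) : LevelRel (fun k : ℕ =>
    virOut c h' (Int.negSucc k) - virOut c h' 0 + h • LinearMap.id) := by
  intro j k r
  have e1 := virOut_comm c h' (Int.negSucc j) (Int.negSucc k) r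
  have e2 := virOut_comm c h' (Int.negSucc j) 0 r
  have e3 := virOut_comm c h' 0 (Int.negSucc k) r
  have d : Int.negSucc j + Int.negSucc k = Int.negSucc (j + k + 1) := by omega
  have z1 : central c (Int.negSucc j) (Int.negSucc k) = 0 := by
    unfold central
    rw [if_neg (by omega)]
  have z2 : central c (Int.negSucc j) 0 = 0 := by
    unfold central
    rw [if_neg (by omega)]
  have z3 : central c 0 (Int.negSucc k) = 0 := by
    unfold central
    rw [if_neg (by omega)]
  rw [z1, d] at e1
  rw [z2, add_zero] at e2
  rw [z3, zero_add] at e3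
  simp only [Int.cast_negSucc, Int.cast_zero] at e1 e2 e3
  push_cast at e1 e2 e3
  simp only [LinearMap.add_apply, LinearMap.sub_apply, LinearMap.smul_apply, LinearMap.id_apply,
    map_add, map_sub, map_smul]
  linear_combination (norm := module) e1 - e2 - e3

/-- The out-state `V^L(1) |h⟩`: the functional `u ↦ ⟨u| V^L(1) |h⟩` on the Verma module of
highest weight `h'`, normalised by `⟨h'| V^L(1) |h⟩ = 1`. -/
def virVertexVac (h h' δ : ℂ) : Module.Dual ℂ Verma :=
  levelExtend δ (levelRel_scalar (h' - h)) 1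

/-- The primary field `V^L(1)` of conformal dimension `δ`, from the Verma module of highest weight
`h` to the out-states of highest weight `h'`, normalised by `⟨h'| V^L(1) |h⟩ = 1`. -/
def virVertex (c h h' δ : ℂ) : Verma →ₗ[ℂ] Module.Dual ℂ Verma :=
  levelExtend δ (levelRel_out c h h') (virVertexVac h h' δ)

lemma virVertex_one_one (c h h' δ : ℂ) : virVertex c h h' δ 1 1 = 1 := by
  rw [virVertex, levelExtend_one, virVertexVac, levelExtend_one]

lemma virVertex_low_mul (c h h' δ : ℂ) (k : ℕ) (v : Verma) :
    virVertex c h h' δ (low k * v)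
      = virOut c h' (Int.negSucc k) (virVertex c h h' δ v)
        - virOut c h' 0 (virVertex c h h' δ v)
        + (((k : ℂ) + 1) * δ) • virVertex c h h' δ v + virVertex c h h' δ (virL c h 0 v) := by
  rw [virVertex, levelExtend_low_mul (c := c) (h := h)]
  simp only [LinearMap.add_apply, LinearMap.sub_apply, LinearMap.smul_apply, LinearMap.id_apply]
  module

lemma virVertex_comm_aux (c h h' δ : ℂ) (m : ℤ) (v : Verma) :
    virOut c h' m (virVertex c h h' δ v) - virVertex c h h' δ (virL c h m v)
      = virOut c h' 0 (virVertex c h h' δ v) - virVertex c h h' δ (virL c h 0 v)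
        + ((m : ℂ) * δ) • virVertex c h h' δ v := by
  set V := virVertex c h h' δ with hV
  set O := virOut c h' with hO
  set L := virL c h with hL
  rcases m with m | m
  swap
  · have e := virVertex_low_mul c h h' δ m v
    rw [← virL_negSucc c h, ← hV, ← hO, ← hL] at e
    rw [e, Int.cast_negSucc]
    push_cast
    module
  let E : Verma → Prop := fun v => ∀ m : ℕ,
    O (m : ℤ) (V v) - V (L (m : ℤ) v) = O 0 (V v) - V (L 0 v) + ((m : ℂ) * δ) • V v
  have Eadd : ∀ v w, E v → E w → E (v + w) := by
    intro v w hv hw m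
    simp only [map_add]
    linear_combination (norm := module) hv m + hw m
  have Esmul : ∀ (r : ℂ) v, E v → E (r • v) := by
    intro r v hv m
    simp only [map_smul]
    linear_combination (norm := module) r • hv m
  have Eneg : ∀ (k : ℕ) v, O (Int.negSucc k) (V v) - V (L (Int.negSucc k) v)
      = O 0 (V v) - V (L 0 v) - (((k : ℂ) + 1) * δ) • V v := by
    intro k v
    have e := virVertex_low_mul c h h' δ k v
    rw [← virL_negSucc c h, ← hV, ← hO, ← hL] at e
    rw [e]
    module
  have step : ∀ k v, E v → E (L 0 v) → E (low k * v) := by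
    intro k v hv hv0 m
    rw [← virL_negSucc c h, ← hL]
    generalize hq : Int.negSucc k = q
    have hqc : ((k : ℂ) + 1) = -(q : ℂ) := by
      rw [← hq, Int.cast_negSucc]
      push_cast
      ring
    have Eq : ∀ v, V (L q v) = O q (V v) - O 0 (V v) + V (L 0 v) - ((q : ℂ) * δ) • V v := by
      intro v
      have e := Eneg k v
      rw [hq, hqc] at e
      linear_combination (norm := module) -e
    have Em : ∀ v, E v → ∀ n : ℤ,
        V (L n v) = O n (V v) - O 0 (V v) + V (L 0 v) - ((n : ℂ) * δ) • V v := by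
      intro v hv n
      rcases n with n | n
      · have e := hv n
        rw [Int.ofNat_eq_natCast]
        push_cast
        linear_combination (norm := module) -e
      · have e := Eneg n v
        rw [Int.cast_negSucc]
        push_cast
        linear_combination (norm := module) -e
    have z : ∀ n, central c n 0 = 0 := by
      intro n
      unfold central
      split_ifs with h
      · obtain rfl : n = 0 := by omega
        simp
      · rfl
    have hmc : ((m : ℤ) : ℂ) = (m : ℂ) := Int.cast_natCast m
    have cmq : V (L m (L q v)) = V (L q (L m v)) + ((m : ℂ) - q) • V (L (m + q) v)
        + central c m q • V v := by
      have e := congrArg V (virL_comm c h m q v)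
      simp only [map_add, map_sub, map_smul, ← hL, hmc] at e
      linear_combination (norm := module) e
    have c0 : ∀ n : ℤ, V (L 0 (L n v)) = V (L n (L 0 v)) - (n : ℂ) • V (L n v) := by
      intro n
      have e := congrArg V (virL_comm c h n 0 v)
      simp only [map_add, map_sub, map_smul, ← hL, z, add_zero, Int.cast_zero] at e
      linear_combination (norm := module) -e
    have o1 := virOut_comm c h' m q (V v)
    have o0 : ∀ n : ℤ, O n (O 0 (V v)) = O 0 (O n (V v)) + (n : ℂ) • O n (V v) := by
      intro n
      have e := virOut_comm c h' n 0 (V v)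
      simp only [← hO, z, add_zero, Int.cast_zero] at e
      linear_combination (norm := module) e
    rw [← hO, sub_eq_iff_eq_add, hmc] at o1
    rw [cmq, c0 q, Eq (L m v), c0 m, Em _ hv0 m, Em _ hv0 q, Em _ hv (m + q), Em _ hv m,
      Em _ hv q]
    simp only [map_add, map_sub, map_smul, o1, o0 m, o0 q, hmc]
    push_cast
    module
  have hlow0 : ∀ k v, L 0 (low k * v) = low k * (L 0 v + ((k : ℂ) + 1) • v) := by
    intro k v
    have e : (0 : ℤ) - k - 1 = Int.negSucc k := by omega
    have e' : central c 0 (-((k : ℤ) + 1)) = 0 := by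
      unfold central
      rw [if_neg (by omega)]
    rw [hL, virL_low_mul, e, virL_negSucc, e', zero_smul, add_zero, mul_add, mul_smul_comm]
    push_cast
    module
  have key : ∀ v, ∀ i : ℕ, E (((L 0) ^ i) v) := by
    intro v
    induction v using verma_induction with
    | one =>
      have h1 : L 0 1 = h • 1 := virL_one c h 0
      have hE : E 1 := by
        intro m
        rcases m with _ | m
        · simp
        · have h2 : L ((m + 1 : ℕ) : ℤ) 1 = 0 := by
            rw [hL, virL_one, vacL_natCast]
            simp
          have h3 : V 1 = virVertexVac h h' δ := by rw [hV, virVertex, levelExtend_one]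
          rw [h1, h2, map_smul, h3]
          refine LinearMap.ext fun u => ?_
          have h4 : -((m + 1 : ℕ) : ℤ) = Int.negSucc m := by omega
          simp only [hO, virOut, h4, map_zero, sub_zero, LinearMap.dualMap_apply,
            LinearMap.add_apply, LinearMap.sub_apply, LinearMap.smul_apply, virL_negSucc,
            neg_zero, smul_eq_mul]
          rw [virVertexVac, levelExtend_low_mul (c := c) (h := h')]
          simp only [LinearMap.smul_apply, LinearMap.id_apply, smul_eq_mul]
          push_cast
          ring
      intro i
      induction i with
      | zero => exact hE
      | succ i ih =>
        rw [pow_succ, Module.End.mul_apply, h1, map_smul]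
        exact Esmul _ _ ih
    | add v w hv hw =>
      intro i
      rw [map_add]
      exact Eadd _ _ (hv i) (hw i)
    | smul r v hv =>
      intro i
      rw [map_smul]
      exact Esmul _ _ (hv i)
    | mul k v hv =>
      intro i
      induction i generalizing v with
      | zero => exact step k v (hv 0) (by simpa using hv 1)
      | succ i ih =>
        rw [pow_succ, Module.End.mul_apply, hlow0]
        refine ih _ fun j => ?_
        rw [map_add, map_smul]
        exact Eadd _ _ (by simpa [pow_succ] using hv (j + 1)) (Esmul _ _ (hv j))
  exact key v 0 m

/-- The defining property of a primary field of dimension `δ`,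
`[L_m, V(z)] = (z^{m+1} ∂_z + (m+1) δ z^m) V(z)`, at `z = 1`; the derivative is eliminated through
the case `m = 0`, which reads `∂_z V(z) = [L_0, V(z)] - δ V(z)` at `z = 1`. -/
theorem virVertex_comm (c h h' δ : ℂ) (m : ℤ) (v : Verma) :
    virOut c h' m (virVertex c h h' δ v) - virVertex c h h' δ (virL c h m v)
      = (virOut c h' 0 (virVertex c h h' δ v) - virVertex c h h' δ (virL c h 0 v)
          - δ • virVertex c h h' δ v)
        + (((m : ℂ) + 1) * δ) • virVertex c h h' δ v := by
  rw [virVertex_comm_aux]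
  module

/-! ### The Heisenberg algebra, its Fock module and the free exponential -/

/-- The Fock module, with vacuum `1`; the variable with index `k` stands for `a_{-(k+1)}`. -/
abbrev Fock : Type := MvPolynomial ℕ ℂ

/-- The operator `a_n` on the Fock module: multiplication by a variable for `n < 0`, and
`a_n = (n / 2) ∂ / ∂a_{-n}` for `n > 0`. The mode `a_0` plays no role and is set to `0`. -/
def heisA : ℤ → Module.End ℂ Fock
  | Int.ofNat 0 => 0
  | Int.ofNat (k + 1) => (((k : ℂ) + 1) / 2) • (MvPolynomial.pderiv k).toLinearMap
  | Int.negSucc k => LinearMap.mulLeft ℂ (MvPolynomial.X k)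

/-- The Heisenberg commutation relations `[a_n, a_m] = (n / 2) δ_{n+m,0}`. -/
theorem heisA_comm (n m : ℤ) (f : Fock) :
    heisA n (heisA m f) - heisA m (heisA n f) = (if n + m = 0 then (n : ℂ) / 2 else 0) • f := by
  have key : ∀ (j k : ℕ), (MvPolynomial.pderiv j (MvPolynomial.pderiv k f) : Fock)
      = MvPolynomial.pderiv k (MvPolynomial.pderiv j f) := by
    intro j k
    have e : ⁅(MvPolynomial.pderiv j : Derivation ℂ Fock Fock),
        (MvPolynomial.pderiv k : Derivation ℂ Fock Fock)⁆ = 0 := by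
      refine MvPolynomial.derivation_ext fun i => ?_
      simp [Derivation.commutator_apply, MvPolynomial.pderiv_X, Pi.single_apply, apply_ite]
    have e' := congrArg (fun D : Derivation ℂ Fock Fock => D f) e
    simpa [Derivation.commutator_apply, sub_eq_zero] using e'
  have one : ∀ (n : ℕ) (k : ℕ), heisA (n : ℤ) (heisA (Int.negSucc k) f)
      - heisA (Int.negSucc k) (heisA (n : ℤ) f)
      = (if (n : ℤ) + Int.negSucc k = 0 then (n : ℂ) / 2 else 0) • f := by
    intro n k
    rcases n with _ | n
    · have z : heisA ((0 : ℕ) : ℤ) = 0 := rfl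
      rw [if_neg (by omega), z]
      simp
    · have e : ((n + 1 : ℕ) : ℤ) = Int.ofNat (n + 1) := rfl
      by_cases hnk : n = k
      · subst hnk
        rw [if_pos (by omega), e]
        simp [heisA, MvPolynomial.smul_eq_C_mul]
        ring
      · rw [if_neg (by omega), e]
        simp [heisA, MvPolynomial.smul_eq_C_mul, MvPolynomial.pderiv_X_of_ne (Ne.symm hnk)]
        ring
  rcases n with n | n <;> rcases m with m | m
  · have hz : (if Int.ofNat n + Int.ofNat m = 0 then ((Int.ofNat n : ℤ) : ℂ) / 2 else 0) = 0 := by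
      split_ifs with h
      · rw [Int.ofNat_eq_natCast, Int.ofNat_eq_natCast] at h
        obtain rfl : n = 0 := by omega
        simp
      · rfl
    rw [hz]
    rcases n with _ | n <;> rcases m with _ | m
    · simp [heisA]
    · simp [heisA]
    · simp [heisA]
    · simp [heisA, key n m, smul_smul, mul_comm]
  · simpa using one n m
  · rw [← neg_sub]
    have e := one m n
    rw [Int.ofNat_eq_natCast, e, add_comm]
    split_ifs with h
    · have : ((Int.negSucc n : ℤ) : ℂ) = -(m : ℂ) := by
        have : Int.negSucc n = -(m : ℤ) := by omega
        rw [this]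
        push_cast
        ring
      rw [this]
      module
    · simp
  · rw [if_neg (by omega)]
    simp [heisA, mul_left_comm]

/-- The operator `a_n` on the (completed) space of out-states, realised as the full dual of the
Fock module through the conjugation `a_n⁺ = a_{-n}`. -/
def heisOut (n : ℤ) : Module.End ℂ (Module.Dual ℂ Fock) := (heisA (-n)).dualMap

/-- The bilinear form on the Fock module with `⟨1, 1⟩ = 1` for which `a_n` and `a_{-n}` are
adjoint: distinct monomials are orthogonal, and
`∏ a_{-(k+1)}^{m k}` has square `∏ (m k)! ((k+1)/2)^{m k}`. -/
def fockForm : Fock →ₗ[ℂ] Module.Dual ℂ Fock :=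
  (MvPolynomial.basisMonomials ℕ ℂ).constr ℂ fun m =>
    (m.prod fun k e => (e.factorial : ℂ) * (((k : ℂ) + 1) / 2) ^ e) • MvPolynomial.lcoeff ℂ m

lemma fockForm_monomial (m m' : ℕ →₀ ℕ) (r r' : ℂ) :
    fockForm (MvPolynomial.monomial m r) (MvPolynomial.monomial m' r')
      = if m = m' then
          r * r' * m.prod fun k e => (e.factorial : ℂ) * (((k : ℂ) + 1) / 2) ^ e
        else 0 := by
  have h : (MvPolynomial.monomial m r : Fock) = r • MvPolynomial.basisMonomials ℕ ℂ m := by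
    simp [MvPolynomial.coe_basisMonomials, MvPolynomial.smul_monomial]
  rw [h, map_smul, fockForm, Module.Basis.constr_basis]
  simp only [LinearMap.smul_apply, smul_eq_mul, MvPolynomial.lcoeff_apply,
    MvPolynomial.coeff_monomial]
  by_cases e : m = m'
  · subst e
    simp
    ring
  · rw [if_neg e, if_neg (fun h => e h.symm)]
    simp

lemma fockForm_symm (f g : Fock) : fockForm f g = fockForm g f := by
  suffices fockForm = fockForm.flip from LinearMap.congr_fun (LinearMap.congr_fun this f) g
  refine MvPolynomial.linearMap_ext fun m => LinearMap.ext_ring ?_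
  refine MvPolynomial.linearMap_ext fun m' => LinearMap.ext_ring ?_
  simp only [LinearMap.comp_apply, LinearMap.flip_apply, fockForm_monomial]
  by_cases e : m = m'
  · subst e
    rfl
  · rw [if_neg e, if_neg (fun h => e h.symm)]

lemma fockForm_X_mul (k : ℕ) (g f : Fock) :
    fockForm (MvPolynomial.X k * g) f
      = (((k : ℂ) + 1) / 2) * fockForm g (MvPolynomial.pderiv k f) := by
  suffices fockForm ∘ₗ LinearMap.mulLeft ℂ (MvPolynomial.X k : Fock)
      = (((k : ℂ) + 1) / 2) • (MvPolynomial.pderiv k).toLinearMap.dualMap ∘ₗ fockForm from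
    LinearMap.congr_fun (LinearMap.congr_fun this g) f
  refine MvPolynomial.linearMap_ext fun m => LinearMap.ext_ring ?_
  refine MvPolynomial.linearMap_ext fun m' => LinearMap.ext_ring ?_
  have hw : (m + Finsupp.single k 1).prod
        (fun k e => (e.factorial : ℂ) * (((k : ℂ) + 1) / 2) ^ e)
      = ((m k : ℂ) + 1) * (((k : ℂ) + 1) / 2)
        * m.prod (fun k e => (e.factorial : ℂ) * (((k : ℂ) + 1) / 2) ^ e) := by
    rw [← Finsupp.mul_prod_erase' (m + Finsupp.single k 1) k _ (by simp),
      ← Finsupp.mul_prod_erase' m k _ (by simp), Finsupp.erase_add, Finsupp.erase_single, add_zero]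
    simp [Nat.factorial_succ, pow_succ]
    ring
  simp only [LinearMap.comp_apply, LinearMap.smul_apply, LinearMap.dualMap_apply,
    LinearMap.mulLeft_apply, MvPolynomial.X, MvPolynomial.monomial_mul,
    Derivation.coeFn_coe, MvPolynomial.pderiv_monomial,
    fockForm_monomial, smul_eq_mul]
  by_cases e : Finsupp.single k 1 + m = m'
  · subst e
    rw [if_pos rfl, if_pos (by simp), add_comm (Finsupp.single k 1), hw]
    simp
    ring
  · rw [if_neg e]
    split_ifs with h
    · have hk : m' k = 0 := by
        by_contra hk
        apply e
        rw [h]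
        ext i
        by_cases hi : i = k
        · subst hi
          simp
          omega
        · simp [Ne.symm hi]
      simp [hk]
    · simp

lemma fockForm_adjoint (n : ℤ) (g f : Fock) :
    fockForm (heisA (-n) g) f = fockForm g (heisA n f) := by
  rcases n with (_ | n) | n
  · simp [heisA]
  · have e : -Int.ofNat (n + 1) = Int.negSucc n := rfl
    rw [e]
    simp [heisA, fockForm_X_mul]
  · have e : -Int.negSucc n = Int.ofNat (n + 1) := rfl
    rw [e, fockForm_symm g, fockForm_symm _ f]
    simp [heisA, fockForm_X_mul]

/-- The operator `exp (t ∑ ∂ / ∂a_{-k})` on the Fock module, that is, the translation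
`a_{-k} ↦ a_{-k} + t`. -/
def fockShift (t : ℂ) : Fock →ₐ[ℂ] Fock :=
  MvPolynomial.aeval fun k => MvPolynomial.X k + MvPolynomial.C t

/-- The free exponential `e^{2(α-Q)φ₋} e^{2αφ₊}` at `z = 1`, from the Fock module to out-states.
Here `2αφ₊ = 2αi ∑_{n>0} a_n / n = iα ∑ ∂ / ∂a_{-n}`, and the conjugate of `2(α-Q)φ₋` is
`2i(Q-α) ∑_{n>0} a_n / n = i(Q-α) ∑ ∂ / ∂a_{-n}`; so
`⟨g| e^{2(α-Q)φ₋} e^{2αφ₊} |f⟩ = ⟨e^{i(Q-α)∑∂} g, e^{iα∑∂} f⟩`. -/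
def heisVertex (Q α : ℂ) : Fock →ₗ[ℂ] Module.Dual ℂ Fock :=
  (fockShift (Complex.I * (Q - α))).toLinearMap.dualMap ∘ₗ fockForm ∘ₗ (fockShift (Complex.I * α)).toLinearMap

lemma fockShift_pderiv (t : ℂ) (k : ℕ) (f : Fock) :
    fockShift t (MvPolynomial.pderiv k f) = MvPolynomial.pderiv k (fockShift t f) := by
  induction f using MvPolynomial.induction_on with
  | C a => simp [fockShift]
  | add p q hp hq => simp [hp, hq]
  | mul_X p i hp =>
    by_cases hi : i = k
    · subst hi
      simp only [Derivation.leibniz, map_add, map_mul, smul_eq_mul, MvPolynomial.pderiv_X_self, hp]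
      simp [fockShift]
    · simp only [Derivation.leibniz, map_add, map_mul, smul_eq_mul,
        MvPolynomial.pderiv_X_of_ne hi, hp]
      simp [fockShift, MvPolynomial.pderiv_X_of_ne hi]

lemma heisVertex_apply (Q α : ℂ) (f g : Fock) : heisVertex Q α f g
    = fockForm (fockShift (Complex.I * α) f) (fockShift (Complex.I * (Q - α)) g) := rfl

/-- The commutation relations of the free exponential with `a_n`, `n < 0`, at `z = 1`. -/
theorem heisVertex_comm_neg (Q α : ℂ) {n : ℤ} (hn : n < 0) (f : Fock) :
    heisOut n (heisVertex Q α f) - heisVertex Q α (heisA n f)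
      = (-Complex.I * α) • heisVertex Q α f := by
  obtain ⟨k, rfl⟩ := Int.eq_negSucc_of_lt_zero hn
  refine LinearMap.ext fun g => ?_
  have e : -Int.negSucc k = Int.ofNat (k + 1) := rfl
  simp only [heisOut, LinearMap.sub_apply, LinearMap.dualMap_apply, LinearMap.smul_apply,
    heisVertex_apply, e, smul_eq_mul]
  simp only [heisA, LinearMap.smul_apply, Derivation.coeFn_coe,
    LinearMap.mulLeft_apply, map_smul, map_mul, fockShift_pderiv, smul_eq_mul]
  have e2 : fockShift (Complex.I * α) (MvPolynomial.X k)
      = MvPolynomial.X k + MvPolynomial.C (Complex.I * α) := by simp [fockShift]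
  rw [e2, add_mul, map_add, LinearMap.add_apply, fockForm_X_mul, ← MvPolynomial.smul_eq_C_mul,
    map_smul, LinearMap.smul_apply, smul_eq_mul]
  ring

/-- The commutation relations of the free exponential with `a_n`, `n > 0`, at `z = 1`. -/
theorem heisVertex_comm_pos (Q α : ℂ) {n : ℤ} (hn : 0 < n) (f : Fock) :
    heisOut n (heisVertex Q α f) - heisVertex Q α (heisA n f)
      = (Complex.I * (Q - α)) • heisVertex Q α f := by
  obtain ⟨k, rfl⟩ : ∃ k : ℕ, n = Int.ofNat (k + 1) := ⟨(n - 1).toNat, by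
    rw [Int.ofNat_eq_natCast]
    omega⟩
  refine LinearMap.ext fun g => ?_
  have e : -Int.ofNat (k + 1) = Int.negSucc k := rfl
  simp only [heisOut, LinearMap.sub_apply, LinearMap.dualMap_apply, LinearMap.smul_apply,
    heisVertex_apply, e, smul_eq_mul]
  simp only [heisA, LinearMap.smul_apply, Derivation.coeFn_coe,
    LinearMap.mulLeft_apply, map_smul, map_mul, fockShift_pderiv, smul_eq_mul]
  have e2 : fockShift (Complex.I * (Q - α)) (MvPolynomial.X k)
      = MvPolynomial.X k + MvPolynomial.C (Complex.I * (Q - α)) := by simp [fockShift]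
  rw [e2, add_mul, map_add, fockForm_symm _ (MvPolynomial.X k * _), fockForm_X_mul,
    ← MvPolynomial.smul_eq_C_mul, map_smul, smul_eq_mul, fockForm_symm _ (MvPolynomial.pderiv k _)]
  ring

/-! ### The highest weight modules of the algebra `Vir ⊗ H` and the primary field `V_α` -/

/-- `Q = b + 1 / b`. -/
def bgCharge (b : ℂ) : ℂ := b + 1 / b

/-- The central charge `c = 1 + 6 Q²`. -/
def centralCharge (b : ℂ) : ℂ := 1 + 6 * bgCharge b ^ 2

/-- The conformal dimension `Q² / 4 - P²` of the momentum `P`. -/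
def dimP (b P : ℂ) : ℂ := bgCharge b ^ 2 / 4 - P ^ 2

/-- The conformal dimension `α (Q - α)` of the primary field `V_α`. -/
def dimV (b α : ℂ) : ℂ := α * (bgCharge b - α)

/-- The space of the highest weight module of `Vir ⊗ H`. -/
abbrev State : Type := Fock ⊗[ℂ] Verma

/-- The vacuum `|P⟩`. -/
def vac : State := 1 ⊗ₜ[ℂ] 1

/-- The operator `L_n` on the module with vacuum `|P⟩`. -/
def opL (b P : ℂ) (n : ℤ) : Module.End ℂ State :=
  LinearMap.lTensor Fock (virL (centralCharge b) (dimP b P) n)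

/-- The operator `a_n`. -/
def opA (n : ℤ) : Module.End ℂ State := LinearMap.rTensor Verma (heisA n)

/-- The (completed) space of out-states: a vector `Φ` is given by all the numbers
`Φ u = ⟨u|Φ⟩`, where `⟨u|` is the conjugate of the state `u`. In particular
`⟨P|Φ⟩ = Φ vac`. -/
abbrev OutState : Type := Module.Dual ℂ State

/-- `L_n` on out-states: `⟨u|L_n Φ⟩ = ⟨L_{-n} u|Φ⟩`, as `L_n⁺ = L_{-n}`. -/
def outL (b P : ℂ) (n : ℤ) : Module.End ℂ OutState := (opL b P (-n)).dualMap

/-- `a_n` on out-states: `⟨u|a_n Φ⟩ = ⟨a_{-n} u|Φ⟩`, as `a_n⁺ = a_{-n}`. -/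
def outA (n : ℤ) : Module.End ℂ OutState := (opA (-n)).dualMap

/-- The primary field `V_α = V_α(1)`, the product of the free exponential and of the Virasoro
primary field of dimension `α (Q - α)`, from the module with vacuum `|P⟩` to the out-states of the
module with vacuum `|P'⟩`, normalised by `⟨P'|V_α|P⟩ = 1`. -/
def primary (b α P' P : ℂ) : State →ₗ[ℂ] OutState :=
  TensorProduct.dualDistrib ℂ Fock Verma
    ∘ₗ TensorProduct.map (heisVertex (bgCharge b) α)
      (virVertex (centralCharge b) (dimP b P) (dimP b P') (dimV b α))

/-! ### Monomials indexed by Young diagrams and level `N` elements -/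

/-- `a_{-l_m} ⋯ a_{-l_1}` for the Young diagram with rows `l_1 ≥ ⋯ ≥ l_m`. -/
def aNeg (lam : YoungDiagram) : Module.End ℂ State :=
  (lam.rowLens.reverse.map fun l : ℕ => opA (-(l : ℤ))).prod

/-- `L_{-k_n} ⋯ L_{-k_1}` for the Young diagram with rows `k_1 ≥ ⋯ ≥ k_n`. -/
def lNeg (b P : ℂ) (lam : YoungDiagram) : Module.End ℂ State :=
  (lam.rowLens.reverse.map fun k : ℕ => opL b P (-(k : ℤ))).prod

/-- `(a_{-l_m} ⋯ a_{-l_1})⁺ = a_{l_1} ⋯ a_{l_m}`, acting on out-states. -/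
def aPos (mu : YoungDiagram) : Module.End ℂ OutState :=
  (mu.rowLens.map fun l : ℕ => outA (l : ℤ)).prod

/-- `(L_{-k_n} ⋯ L_{-k_1})⁺ = L_{k_1} ⋯ L_{k_n}`, acting on out-states. -/
def lPos (b P : ℂ) (mu : YoungDiagram) : Module.End ℂ OutState :=
  (mu.rowLens.map fun k : ℕ => outL b P (k : ℤ)).prod

/-- A formal linear combination `∑ C^σ a_{-σ₁} L_{-σ₂}` over pairs of Young diagrams, given by its
coefficients. -/
abbrev Element : Type := YoungDiagram × YoungDiagram →₀ ℂ

/-- An element is of level `N` if only pairs with `|σ₁| + |σ₂| = N` occur in it. -/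
def Element.IsLevel (Y : Element) (N : ℕ) : Prop :=
  ∀ σ : YoungDiagram × YoungDiagram, Y σ ≠ 0 → σ.1.card + σ.2.card = N

/-- The operator `∑ C^σ a_{-σ₁} L_{-σ₂}` on the module with vacuum `|P⟩`. -/
def Element.op (Y : Element) (b P : ℂ) : Module.End ℂ State :=
  Y.sum fun σ C => C • (aNeg σ.1 * lNeg b P σ.2)

/-- The normalised matrix element `⟨P'|L_{μ₁} a_{μ₂} V_α Y|P⟩ / ⟨P'|V_α|P⟩`. -/
def matrixElement (b α P' P : ℂ) (mu₁ mu₂ : YoungDiagram) (Y : Element) : ℂ :=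
  lPos b P' mu₁ (aPos mu₂ (primary b α P' P (Y.op b P vac))) vac

lemma primary_vac (b α P' P : ℂ) : primary b α P' P vac vac = 1 := by
  have h : fockForm 1 1 = 1 := by
    have := fockForm_monomial 0 0 1 1
    simpa using this
  simp [primary, vac, heisVertex_apply, virVertex_one_one, h]

end VirHeis

end

open scoped TensorProduct

noncomputable section

namespace VirHeis

/-! ### Derivations of weighted polynomial rings -/

section Weighted

open MvPolynomial

variable {σ : Type} {w : σ → ℕ}

/-! The argument is semiclassical. Give $a_{-k}$ degree 1 and $L_{-k}$ degree 2. Reordering a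
product only produces terms of lower degree, so the part of top degree of a state lives in a
commutative polynomial ring: this is its symbol (`HasSymbol`). Replace $\alpha$ and $P'$ by
$t\alpha$ and $tP'$ and let $t\to\infty$. Moving $a_{-k}$ through $V_\alpha$ to the out-vacuum
yields the factor $i\alpha$, and moving $L_{-k}$ yields $P'^2-k\alpha^2$ to leading order. A state
of degree $e$ with symbol $p$ therefore has $\langle P'|V_\alpha y|P\rangle\sim
t^e\,p(i\alpha,\,P'^2-k\alpha^2)$ (`HasSymbol.tendsto`), and if $y$ is null of positive level, $p$
vanishes at all these points.

These points alone do not determine $p$, so nullity is propagated downwards. The commutation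
relations with $V_\alpha$ show that if $y$ is null up to level $N$, then $a_k y$ is null up to level
$N-k$ and $L_j y-L_0 y$ up to level $N-j$ (`IsNull.opA`, `IsNull.opL_sub`). On symbols, $a_k$ is a
multiple of a partial derivative and $L_j$ is the derivation `symL`, up to a scalar when $j=0$.
Induction on $N$ (`IsNull.symbol_eq_zero`) shows that these derivatives of $p$ vanish for $k,j<N$.
Hence no $a_{-k}$ with $k<N$ occurs in $p$; $a_{-N}$ could occur only linearly and is excluded
because its value $i\alpha$ is odd in $\alpha$ (`inl_notMem_vars`). The equations for $L_j$ then
leave only a multiple of $L_{-1}^N$, excluded by evaluation (`eq_zero_of_symL_eq_zero`).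

Finally, if $Y\ne 0$, its terms of maximal degree form a nonzero symbol, a contradiction. Symbols
are never assumed unique and no linear independence of ordered monomials in the Verma module is
used: since $0$ is null, that independence comes out of the same argument. Only the spanning half,
by reordering, is needed. -/

lemma isWeightedHomogeneous_derivation (D : Derivation ℂ (MvPolynomial σ ℂ) (MvPolynomial σ ℂ))
    {j : ℕ} (hD : ∀ i, D (X i) = 0 ∨ ∃ d, d + j = w i ∧ (D (X i)).IsWeightedHomogeneous w d)
    {p : MvPolynomial σ ℂ} {n n' : ℕ} (hp : p.IsWeightedHomogeneous w n) (hn : n' + j = n) :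
    (D p).IsWeightedHomogeneous w n' := by
  rw [p.as_sum, map_sum, ← mem_weightedHomogeneousSubmodule]
  refine Submodule.sum_mem _ fun m hm => ?_
  have hmn : Finsupp.weight w m = n := hp (mem_support_iff.mp hm)
  -- A derivation is determined by its values on the variables, which gives access to the explicit
  -- formula on monomials.
  rw [show D = mkDerivation ℂ (fun i => D (X i)) from derivation_ext fun i => by simp]
  rw [mkDerivation_monomial]
  refine Submodule.smul_mem _ _ (Submodule.sum_mem _ fun i hi => ?_)
  rcases hD i with h | ⟨d, hd, h⟩
  · simp [h]
  · have e := Finsupp.weight_sub_single_add (w := w) (Finsupp.mem_support_iff.mp hi)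
    have h1 := (isWeightedHomogeneous_monomial w (m - Finsupp.single i 1) (m i : ℂ) rfl).mul h
    have e2 : Finsupp.weight w (m - Finsupp.single i 1) + d = n' := by omega
    rw [e2] at h1
    exact h1

/-- Euler's identity for weighted homogeneous polynomials, checked monomial by monomial. -/
lemma eulerDerivation_apply {p : MvPolynomial σ ℂ} {n : ℕ} (hp : p.IsWeightedHomogeneous w n) :
    mkDerivation ℂ (fun i => (w i : ℂ) • (X i : MvPolynomial σ ℂ)) p = (n : ℂ) • p := by
  conv_lhs => rw [p.as_sum]
  conv_rhs => rw [p.as_sum]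
  rw [map_sum, Finset.smul_sum]
  refine Finset.sum_congr rfl fun m hm => ?_
  have hmn : Finsupp.weight w m = n := hp (mem_support_iff.mp hm)
  rw [mkDerivation_monomial]
  have h : (m.sum fun i k => monomial (m - Finsupp.single i 1) (k : ℂ) • ((w i : ℂ) •
      (X i : MvPolynomial σ ℂ))) = m.sum fun i k => monomial m ((k : ℂ) * w i) := by
    refine Finset.sum_congr rfl fun i hi => ?_
    have e : m - Finsupp.single i 1 + Finsupp.single i 1 = m := by
      refine tsub_add_cancel_of_le ?_
      rw [Finsupp.single_le_iff]
      exact Nat.one_le_iff_ne_zero.mpr (Finsupp.mem_support_iff.mp hi)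
    simp only [smul_eq_mul, X, monomial_mul, e, smul_monomial]
    congr 1
    ring
  rw [h, ← hmn, Finsupp.weight_apply]
  simp only [Finsupp.sum, ← map_sum, smul_monomial, smul_eq_mul]
  congr 1
  push_cast
  ring

/-- In characteristic zero, a monomial containing the variable contributes to the derivative with a
nonzero multiple of its own coefficient. -/
lemma notMem_vars_of_pderiv_eq_zero {i : σ} {p : MvPolynomial σ ℂ} (h : pderiv i p = 0) :
    i ∉ p.vars := by
  rw [mem_vars_iff_mem_support]
  rintro ⟨m, hm, hi⟩
  have e : m - Finsupp.single i 1 + Finsupp.single i 1 = m := by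
    refine tsub_add_cancel_of_le ?_
    rw [Finsupp.single_le_iff]
    exact Nat.one_le_iff_ne_zero.mpr (Finsupp.mem_support_iff.mp hi)
  have h2 := coeff_pderiv (i := i) p (m - Finsupp.single i 1)
  rw [h, coeff_zero, e] at h2
  rcases mul_eq_zero.mp h2.symm with h3 | h3
  · exact mem_support_iff.mp hm h3
  · exact Nat.cast_add_one_ne_zero _ h3

lemma notMem_vars_of_lt_weight {i : σ} {p : MvPolynomial σ ℂ} {n : ℕ}
    (hp : p.IsWeightedHomogeneous w n) (h : n < w i) : i ∉ p.vars := by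
  rw [mem_vars_iff_mem_support]
  rintro ⟨m, hm, hi⟩
  have hmn : Finsupp.weight w m = n := hp (mem_support_iff.mp hm)
  have e := Finsupp.weight_sub_single_add (w := w) (Finsupp.mem_support_iff.mp hi)
  omega

/-- A weighted homogeneous polynomial in one variable is a multiple of a power. -/
lemma eq_smul_X_pow {i : σ} {p : MvPolynomial σ ℂ} {n : ℕ}
    (hp : p.IsWeightedHomogeneous w n) (hw : w i = 1) (h : ∀ j ∈ p.vars, j = i) :
    ∃ c : ℂ, p = c • X i ^ n := by
  refine ⟨coeff (Finsupp.single i n) p, ?_⟩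
  have key : ∀ m ∈ p.support, m = Finsupp.single i n := by
    intro m hm
    have hmn : Finsupp.weight w m = n := hp (mem_support_iff.mp hm)
    have hs : m = Finsupp.single i (m i) := by
      ext j
      by_cases hj : j = i
      · subst hj
        simp
      · rw [Finsupp.single_eq_of_ne hj]
        by_contra h0
        exact hj (h j ((mem_vars_iff_mem_support j).mpr ⟨m, hm, Finsupp.mem_support_iff.mpr h0⟩))
    rw [hs, Finsupp.weight_single, hw] at hmn
    rw [hs]
    simp at hmn
    rw [hmn]
  classical
  ext m
  rw [X_pow_eq_monomial, coeff_smul, coeff_monomial]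
  by_cases hm : m ∈ p.support
  · simp [key m hm]
  · rw [notMem_support_iff.mp hm]
    split_ifs with h1
    · rw [h1, notMem_support_iff.mp hm]
      simp
    · simp

end Weighted

/-! ### The symbol algebra -/

/-- The polynomial ring of symbols: `inl k` stands for `a_{-(k+1)}` and `inr k` for
`L_{-(k+1)}`. -/
abbrev SymbolRing : Type := MvPolynomial (ℕ ⊕ ℕ) ℂ

/-- The level of a variable. -/
def varLevel : ℕ ⊕ ℕ → ℕ := Sum.elim (· + 1) (· + 1)

/-- All variables have positive level, so only the constant monomial has level 0; `inl_notMem_vars`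
relies on this. -/
instance : Finsupp.NonTorsionWeight ℕ varLevel :=
  Finsupp.nonTorsionWeight_of ℕ varLevel (by rintro (k | k) <;> simp [varLevel])

/-- The symbol of the operator `L_j`, `j ≥ 0`. -/
def symL (j : ℕ) : Derivation ℂ SymbolRing SymbolRing :=
  MvPolynomial.mkDerivation ℂ <| Sum.elim (fun _ => 0) fun k =>
    if j ≤ k then ((j : ℂ) + k + 1) • MvPolynomial.X (Sum.inr (k - j)) else 0

@[simp] lemma symL_X_inl (j k : ℕ) : symL j (MvPolynomial.X (Sum.inl k)) = 0 := by
  simp [symL]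

lemma symL_X_inr (j k : ℕ) : symL j (MvPolynomial.X (Sum.inr k)) =
    if j ≤ k then ((j : ℂ) + k + 1) • MvPolynomial.X (Sum.inr (k - j)) else 0 := by
  simp [symL]

lemma symL_isWeightedHomogeneous {j n n' : ℕ} {p : SymbolRing}
    (hp : p.IsWeightedHomogeneous varLevel n) (hn : n' + j = n) :
    (symL j p).IsWeightedHomogeneous varLevel n' := by
  refine isWeightedHomogeneous_derivation (symL j) (j := j) (fun i => ?_) hp hn
  rcases i with k | k
  · simp
  · rw [symL_X_inr]
    split_ifs with h
    · refine Or.inr ⟨k - j + 1, ?_, ?_⟩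
      · simp only [varLevel, Sum.elim_inr]
        omega
      · rw [← MvPolynomial.mem_weightedHomogeneousSubmodule]
        exact Submodule.smul_mem _ _ (MvPolynomial.isWeightedHomogeneous_X ℂ varLevel
          (Sum.inr (k - j)))
    · exact Or.inl rfl

/-- On polynomials in the $L_{-k}$ alone, `symL 0` agrees with the Euler derivation. The restriction
on variables is essential: the Virasoro $L_0$ does not see the level of the $a_{-k}$. -/
lemma symL_zero_apply {n : ℕ} {p : SymbolRing} (hp : p.IsWeightedHomogeneous varLevel n)
    (h : ∀ k, Sum.inl k ∉ p.vars) : symL 0 p = (n : ℂ) • p := by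
  rw [← eulerDerivation_apply hp]
  refine MvPolynomial.derivation_eq_of_forall_mem_vars fun i hi => ?_
  rcases i with k | k
  · exact absurd hi (h k)
  · rw [symL_X_inr, if_pos (Nat.zero_le k), MvPolynomial.mkDerivation_X]
    simp [varLevel]

/-- The point of the symbol algebra governing the leading behaviour of the matrix elements
`⟨P'|V_α Y|P⟩`. -/
def symPoint (α P' : ℂ) : ℕ ⊕ ℕ → ℂ :=
  Sum.elim (fun _ => Complex.I * α) fun k => P' ^ 2 - ((k : ℂ) + 1) * α ^ 2

/-- If `inr K` is the highest variable that may occur in $p$, then `symL K` kills every lower one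
and sends `inr K` to a nonzero multiple of `inr 0`. So `symL K p = 0` forces the derivative in `inr
K` to vanish. Descending in $K$ leaves only powers of `inr 0`, the symbol of $L_{-1}$. -/
lemma eq_zero_of_symL_eq_zero {n : ℕ} {p : SymbolRing}
    (hp : p.IsWeightedHomogeneous varLevel n) (hv : ∀ k, Sum.inl k ∉ p.vars)
    (hL : ∀ j, 0 < j → j < n → symL j p = 0)
    (h0 : ∀ α P' : ℂ, MvPolynomial.eval (symPoint α P') p = 0) : p = 0 := by
  -- Descending induction on `K`, encoded by the gap `d`; for `n ≤ K` the variable already has level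
  -- greater than `n`.
  have key : ∀ d K : ℕ, n < K + d → 0 < K → Sum.inr K ∉ p.vars := by
    intro d
    induction d with
    | zero =>
      intro K hK _
      exact notMem_vars_of_lt_weight hp (by simp only [varLevel, Sum.elim_inr]; omega)
    | succ d ih =>
      intro K hK hK0
      by_cases hKn : n ≤ K
      · exact notMem_vars_of_lt_weight hp (by simp only [varLevel, Sum.elim_inr]; omega)
      have hlater : ∀ k, K < k → Sum.inr k ∉ p.vars := fun k hk => ih k (by omega) (by omega)
      have e : symL K p = ((2 * (K : ℂ) + 1) • MvPolynomial.X (Sum.inr 0) : SymbolRing) •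
          MvPolynomial.pderiv (Sum.inr K) p := by
        rw [← Derivation.smul_apply]
        refine MvPolynomial.derivation_eq_of_forall_mem_vars fun i hi => ?_
        rcases i with k | k
        · exact absurd hi (hv k)
        · rw [symL_X_inr, Derivation.smul_apply]
          rcases lt_trichotomy k K with h | rfl | h
          · rw [if_neg (by omega), MvPolynomial.pderiv_X_of_ne (by simpa using h.ne)]
            simp
          · simp only [le_refl, if_true, Nat.sub_self, MvPolynomial.pderiv_X_self, smul_eq_mul,
              mul_one]
            congr 1
            ring
          · exact absurd hi (hlater k h)
      rw [hL K hK0 (by omega), smul_eq_mul] at e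
      refine notMem_vars_of_pderiv_eq_zero ?_
      refine (mul_eq_zero.mp e.symm).resolve_left ?_
      refine smul_ne_zero ?_ (MvPolynomial.X_ne_zero _)
      exact_mod_cast (by omega : 2 * K + 1 ≠ 0)
  obtain ⟨c, hc⟩ := eq_smul_X_pow (i := Sum.inr 0) hp rfl (by
    rintro (k | k) hk
    · exact absurd hk (hv k)
    · by_contra h
      exact key (n + 1) k (by omega) (by
        rcases Nat.eq_zero_or_pos k with rfl | h'
        · exact absurd rfl h
        · exact h') hk)
  -- At $\alpha=0$, $P'=1$ the variable `inr 0` takes the value 1, so the evaluation is the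
  -- coefficient `c`.
  have h1 := h0 0 1
  rw [hc] at h1 ⊢
  simp [symPoint, MvPolynomial.smul_eval] at h1
  simp [h1]

/-- If only the variable `inl (n - 1)` occurs among the `inl k`, the vanishing at all the points
`symPoint α P'` removes it. -/
lemma inl_notMem_vars {n : ℕ} (hn : 0 < n) {p : SymbolRing}
    (hp : p.IsWeightedHomogeneous varLevel n) (hv : ∀ k, k + 1 < n → Sum.inl k ∉ p.vars)
    (h0 : ∀ α P' : ℂ, MvPolynomial.eval (symPoint α P') p = 0) (k : ℕ) :
    Sum.inl k ∉ p.vars := by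
  obtain ⟨N, rfl⟩ : ∃ N, n = N + 1 := ⟨n - 1, by omega⟩
  have hlater : ∀ k, N < k → Sum.inl k ∉ p.vars := fun k hk =>
    notMem_vars_of_lt_weight hp (by simp only [varLevel, Sum.elim_inl]; omega)
  have hne : ∀ k, k ≠ N → Sum.inl k ∉ p.vars := by
    intro k hk
    rcases lt_or_gt_of_ne hk with h | h
    · exact hv k (by omega)
    · exact hlater k h
  -- This variable exhausts the whole level `N + 1`, so a monomial containing it has no room for
  -- another factor.
  have hmono : ∀ m ∈ p.support, Sum.inl N ∈ m.support → m = Finsupp.single (Sum.inl N) 1 := by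
    intro m hm hi
    have hmn : Finsupp.weight varLevel m = N + 1 := hp (MvPolynomial.mem_support_iff.mp hm)
    have e := Finsupp.weight_sub_single_add (w := varLevel) (Finsupp.mem_support_iff.mp hi)
    have e1 : varLevel (Sum.inl N) = N + 1 := rfl
    have e0 : Finsupp.weight varLevel (m - Finsupp.single (Sum.inl N) 1) = 0 := by omega
    have e2 : m - Finsupp.single (Sum.inl N) 1 = 0 :=
      (Finsupp.weight_eq_zero_iff_eq_zero varLevel).mp e0
    have e3 : m - Finsupp.single (Sum.inl N) 1 + Finsupp.single (Sum.inl N) 1 = m := by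
      refine tsub_add_cancel_of_le ?_
      rw [Finsupp.single_le_iff]
      exact Nat.one_le_iff_ne_zero.mpr (Finsupp.mem_support_iff.mp hi)
    rw [← e3, e2, zero_add]
  set s := MvPolynomial.coeff (Finsupp.single (Sum.inl N) 1) p with hs
  set q : SymbolRing := p - s • MvPolynomial.X (Sum.inl N) with hq
  have hqv : ∀ k, Sum.inl k ∉ q.vars := by
    intro k hk
    obtain ⟨m, hm, hi⟩ := (MvPolynomial.mem_vars_iff_mem_support _).mp hk
    rw [MvPolynomial.mem_support_iff, hq, MvPolynomial.coeff_sub, MvPolynomial.coeff_smul] at hm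
    by_cases hms : m = Finsupp.single (Sum.inl N) 1
    · apply hm
      rw [hms, ← hs]
      simp
    · have hX : MvPolynomial.coeff m (MvPolynomial.X (Sum.inl N) : SymbolRing) = 0 := by
        rw [MvPolynomial.coeff_X, if_neg (Ne.symm hms)]
      rw [hX, smul_zero, sub_zero] at hm
      have hmp := MvPolynomial.mem_support_iff.mpr hm
      by_cases hkN : k = N
      · subst hkN
        exact hms (hmono m hmp hi)
      · exact hne k hkN ((MvPolynomial.mem_vars_iff_mem_support _).mpr ⟨m, hmp, hi⟩)
  -- The points for $\alpha=\pm1$ differ only in the `inl` coordinates, which `q` does not involve;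
  -- the difference of the two evaluations of `p` is therefore $2i$ times `s`.
  have heval : MvPolynomial.eval (symPoint 1 0) q = MvPolynomial.eval (symPoint (-1) 0) q := by
    refine MvPolynomial.hom_congr_vars ?_ (fun i hi _ => ?_) rfl
    · ext
      simp
    · rcases i with k | k
      · exact absurd hi (hqv k)
      · simp [symPoint]
  have h1 := h0 1 0
  have h2 := h0 (-1) 0
  have hpq : p = q + s • MvPolynomial.X (Sum.inl N) := by rw [hq]; ring
  rw [hpq] at h1 h2
  simp only [map_add, MvPolynomial.smul_eval, MvPolynomial.eval_X, symPoint, Sum.elim_inl]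
    at h1 h2
  simp only [symPoint] at heval
  have hs0 : s = 0 := by
    have h3 : s * (2 * Complex.I) = 0 := by linear_combination h1 - h2 - heval
    simpa using h3
  rw [hs0, zero_smul, add_zero] at hpq
  rw [hpq]
  exact hqv k

/-! ### Operators on states -/

/-- The operator `L_{-(k+1)}`, which does not depend on the highest weight. -/
def raiseL (k : ℕ) : Module.End ℂ State :=
  LinearMap.lTensor Fock (LinearMap.mulLeft ℂ (low k))

/-- The operator `a_{-(k+1)}`. -/
def raiseA (k : ℕ) : Module.End ℂ State := opA (Int.negSucc k)

lemma raiseL_tmul (k : ℕ) (f : Fock) (v : Verma) : raiseL k (f ⊗ₜ v) = f ⊗ₜ (low k * v) := by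
  simp [raiseL]

lemma raiseA_tmul (k : ℕ) (f : Fock) (v : Verma) :
    raiseA k (f ⊗ₜ v) = (MvPolynomial.X k * f) ⊗ₜ v := by
  simp [raiseA, opA, heisA]

lemma opL_tmul (b P : ℂ) (n : ℤ) (f : Fock) (v : Verma) :
    opL b P n (f ⊗ₜ v) = f ⊗ₜ virL (centralCharge b) (dimP b P) n v := by
  simp [opL]

lemma opA_tmul (n : ℤ) (f : Fock) (v : Verma) : opA n (f ⊗ₜ v) = heisA n f ⊗ₜ v := by
  simp [opA]

lemma opL_negSucc (b P : ℂ) (k : ℕ) : opL b P (Int.negSucc k) = raiseL k := by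
  refine TensorProduct.ext' fun f v => ?_
  rw [opL_tmul, raiseL_tmul, virL_negSucc]

lemma opL_raiseL (b P : ℂ) (n : ℤ) (k : ℕ) (y : State) :
    opL b P n (raiseL k y) = raiseL k (opL b P n y) + ((n : ℂ) + k + 1) • opL b P (n - k - 1) y
      + central (centralCharge b) n (-(k + 1)) • y := by
  induction y using TensorProduct.induction_on with
  | zero => simp
  | add y z hy hz =>
    simp only [map_add, hy, hz, smul_add]
    abel
  | tmul f v =>
    simp only [raiseL_tmul, opL_tmul, virL_low_mul, TensorProduct.tmul_add,
      TensorProduct.tmul_smul]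

lemma opL_opA (b P : ℂ) (n m : ℤ) (y : State) : opL b P n (opA m y) = opA m (opL b P n y) := by
  induction y using TensorProduct.induction_on with
  | zero => simp
  | add y z hy hz => simp only [map_add, hy, hz]
  | tmul f v => simp only [opL_tmul, opA_tmul]

lemma opA_raiseL (n : ℤ) (k : ℕ) (y : State) : opA n (raiseL k y) = raiseL k (opA n y) := by
  -- The parameters `0 0` are arbitrary, since negative modes do not depend on them.
  rw [← opL_negSucc 0 0, opL_opA]

lemma opA_raiseA (j k : ℕ) (y : State) : opA ((j : ℤ) + 1) (raiseA k y)
    = raiseA k (opA ((j : ℤ) + 1) y) + (if j = k then ((j : ℂ) + 1) / 2 else 0) • y := by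
  induction y using TensorProduct.induction_on with
  | zero => simp
  | add y z hy hz =>
    simp only [map_add, hy, hz, smul_add]
    abel
  | tmul f v =>
    have e := heisA_comm ((j : ℤ) + 1) (Int.negSucc k) f
    have h : (if (j : ℤ) + 1 + Int.negSucc k = 0 then ((((j : ℤ) + 1 : ℤ)) : ℂ) / 2 else 0)
        = if j = k then ((j : ℂ) + 1) / 2 else 0 := by
      by_cases hjk : j = k
      · rw [if_pos hjk, if_pos (by omega)]
        push_cast
        rfl
      · rw [if_neg hjk, if_neg (by omega)]
    rw [h, sub_eq_iff_eq_add] at e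
    simp only [raiseA, opA_tmul, e, TensorProduct.add_tmul, TensorProduct.smul_tmul']
    rw [add_comm]

lemma opL_zero_vac (b P : ℂ) : opL b P 0 vac = dimP b P • vac := by
  rw [vac, opL_tmul, virL_one]
  simp [vacL]

lemma opL_pos_vac (b P : ℂ) (j : ℕ) : opL b P ((j : ℤ) + 1) vac = 0 := by
  have e : (j : ℤ) + 1 = ((j + 1 : ℕ) : ℤ) := by push_cast; rfl
  rw [vac, opL_tmul, virL_one, e, vacL_natCast]
  simp

lemma opA_pos_vac (j : ℕ) : opA ((j : ℤ) + 1) vac = 0 := by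
  have e : (j : ℤ) + 1 = Int.ofNat (j + 1) := rfl
  rw [vac, opA_tmul, e]
  simp [heisA]

/-! ### Symbols of states -/

/-- `HasSymbol e y p`: the state `y` is a combination of monomials of degree at most `e`, where
`a_{-k}` has degree `1` and `L_{-k}` has degree `2`, and `p` is its part of degree `e` in
commuting variables. -/
inductive HasSymbol : ℤ → State → SymbolRing → Prop
  | vac : HasSymbol 0 vac 1
  | zero (e : ℤ) : HasSymbol e 0 0
  | add {e : ℤ} {y y' : State} {p p' : SymbolRing} :
      HasSymbol e y p → HasSymbol e y' p' → HasSymbol e (y + y') (p + p')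
  | smul {e : ℤ} {y : State} {p : SymbolRing} (r : ℂ) :
      HasSymbol e y p → HasSymbol e (r • y) (r • p)
  | lower {e : ℤ} {y : State} {p : SymbolRing} : HasSymbol e y p → HasSymbol (e + 1) y 0
  | raiseA {e : ℤ} {y : State} {p : SymbolRing} (k : ℕ) : HasSymbol e y p →
      HasSymbol (e + 1) (raiseA k y) (MvPolynomial.X (Sum.inl k) * p)
  | raiseL {e : ℤ} {y : State} {p : SymbolRing} (k : ℕ) : HasSymbol e y p →
      HasSymbol (e + 2) (raiseL k y) (MvPolynomial.X (Sum.inr k) * p)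

namespace HasSymbol

lemma lower_of_lt {e e' : ℤ} {y : State} {p : SymbolRing} (h : HasSymbol e y p) (he : e < e') :
    HasSymbol e' y 0 := by
  obtain ⟨n, rfl⟩ : ∃ n : ℕ, e' = e + 1 + n := ⟨(e' - e - 1).toNat, by omega⟩
  clear he
  induction n with
  | zero => simpa using h.lower
  | succ n ih => simpa [add_assoc] using ih.lower

lemma sub {e : ℤ} {y y' : State} {p p' : SymbolRing} (h : HasSymbol e y p)
    (h' : HasSymbol e y' p') : HasSymbol e (y - y') (p - p') := by
  have h2 := h.add (h'.smul (-1))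
  have e1 : y + (-1 : ℂ) • y' = y - y' := by module
  have e2 : p + (-1 : ℂ) • p' = p - p' := by module
  rwa [e1, e2] at h2

lemma add_zero {e : ℤ} {y y' : State} {p : SymbolRing} (h : HasSymbol e y p)
    (h' : HasSymbol e y' 0) : HasSymbol e (y + y') p := by
  simpa using h.add h'

lemma sum {ι : Type} {e : ℤ} (s : Finset ι) {y : ι → State} {p : ι → SymbolRing}
    (h : ∀ i ∈ s, HasSymbol e (y i) (p i)) : HasSymbol e (∑ i ∈ s, y i) (∑ i ∈ s, p i) := by
  classical
  induction s using Finset.induction_on with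
  | empty => simpa using HasSymbol.zero e
  | insert a s ha ih =>
    rw [Finset.sum_insert ha, Finset.sum_insert ha]
    exact (h a (Finset.mem_insert_self a s)).add
      (ih fun i hi => h i (Finset.mem_insert_of_mem hi))

/-- The vacuum has degree 0 and no rule lowers the degree. This starts the induction on the degree
in `HasSymbol.tendsto`. -/
lemma eq_zero_of_neg {e : ℤ} {y : State} {p : SymbolRing} (h : HasSymbol e y p) (he : e < 0) :
    y = 0 ∧ p = 0 := by
  induction h with
  | vac => omega
  | zero => simp
  | add _ _ ih ih' => simp [ih he, ih' he]
  | smul _ _ ih => simp [ih he]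
  | lower _ ih => simp [ih (by omega)]
  | raiseA _ _ ih => simp [ih (by omega)]
  | raiseL _ _ ih => simp [ih (by omega)]

/-- The symbol of `L_j y` for `j ≥ 0`. -/
lemma opL {e : ℤ} {y : State} {p : SymbolRing} (h : HasSymbol e y p) (b P : ℂ) (j : ℕ) :
    HasSymbol e (opL b P j y) (symL j p + (if j = 0 then dimP b P else 0) • p) := by
  induction h generalizing j with
  | vac =>
    rcases j with _ | j
    · simpa [opL_zero_vac] using HasSymbol.vac.smul (dimP b P)
    · rw [Nat.cast_succ, opL_pos_vac]
      simpa using HasSymbol.zero 0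
  | zero e => simpa using HasSymbol.zero e
  | add _ _ ih ih' =>
    have h := (ih j).add (ih' j)
    rw [← map_add] at h
    convert h using 1
    rw [map_add, smul_add]
    abel
  | smul r _ ih =>
    have h := (ih j).smul r
    rw [← map_smul] at h
    convert h using 1
    rw [Derivation.map_smul, smul_add, smul_comm r]
  | lower _ ih =>
    simpa using (ih j).lower
  | @raiseA e y p k _ ih =>
    have h := (ih j).raiseA k
    rw [VirHeis.raiseA, ← opL_opA] at h
    change HasSymbol (e + 1) (VirHeis.opL b P j (VirHeis.opA (Int.negSucc k) y)) _
    convert h using 1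
    simp only [Derivation.leibniz, symL_X_inl, smul_eq_mul, mul_zero, _root_.add_zero, mul_add,
      mul_smul_comm]
  | @raiseL e y p k hy ih =>
    rw [opL_raiseL, show symL j (MvPolynomial.X (Sum.inr k) * p)
        + (if j = 0 then dimP b P else 0) • (MvPolynomial.X (Sum.inr k) * p)
      = MvPolynomial.X (Sum.inr k) * (symL j p + (if j = 0 then dimP b P else 0) • p)
        + p * symL j (MvPolynomial.X (Sum.inr k)) by
      simp only [Derivation.leibniz, smul_eq_mul, mul_add, mul_smul_comm]
      abel]
    -- The central term has degree two less than the leading one, hence symbol 0.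
    refine HasSymbol.add_zero (HasSymbol.add ((ih j).raiseL k) ?_)
      (by simpa using (hy.smul _).lower_of_lt (by omega))
    rw [symL_X_inr]
    by_cases hjk : j ≤ k
    · have e1 : (j : ℤ) - k - 1 = Int.negSucc (k - j) := by omega
      rw [if_pos hjk, e1, opL_negSucc]
      have h := (hy.raiseL (k - j)).smul ((j : ℂ) + k + 1)
      rw [Int.cast_natCast, mul_smul_comm, mul_comm]
      exact h
    -- For `j > k` the commutator is a nonnegative mode, which does not raise the degree of `y`;
    -- this matches the zero branch of `symL`.
    · have e1 : (j : ℤ) - k - 1 = ((j - k - 1 : ℕ) : ℤ) := by omega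
      rw [if_neg hjk, e1, mul_zero]
      simpa using ((ih (j - k - 1)).smul _).lower_of_lt (by omega)

/-- The symbol of `a_{j+1} y`. -/
lemma opA {e : ℤ} {y : State} {p : SymbolRing} (h : HasSymbol e y p) (j : ℕ) :
    HasSymbol (e - 1) (opA ((j : ℤ) + 1) y)
      ((((j : ℂ) + 1) / 2) • MvPolynomial.pderiv (Sum.inl j) p) := by
  induction h with
  | vac =>
    rw [opA_pos_vac]
    simpa using HasSymbol.zero _
  | zero e => simpa using HasSymbol.zero _
  | add _ _ ih ih' =>
    have h := ih.add ih'
    rwa [← map_add, ← smul_add, ← map_add] at h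
  | smul r _ ih =>
    have h := ih.smul r
    rw [← map_smul] at h
    convert h using 1
    rw [Derivation.map_smul, smul_comm r]
  | lower _ ih =>
    have h := ih.lower
    rw [sub_add_cancel] at h
    simpa using h
  | @raiseA e y p k hy ih =>
    have h := ih.raiseA k
    rw [sub_add_cancel] at h
    have h2 := h.add (hy.smul (if j = k then ((j : ℂ) + 1) / 2 else 0))
    rw [← opA_raiseA] at h2
    rw [add_sub_cancel_right]
    convert h2 using 1
    rw [Derivation.leibniz, smul_add, smul_eq_mul, mul_smul_comm]
    congr 1
    by_cases hjk : j = k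
    · subst hjk
      simp
    · rw [if_neg hjk, MvPolynomial.pderiv_X_of_ne (by simpa using Ne.symm hjk)]
      simp
  | @raiseL e y p k _ ih =>
    have h := ih.raiseL k
    rw [← opA_raiseL] at h
    convert h using 1
    · ring
    · rw [Derivation.leibniz, smul_eq_mul, MvPolynomial.pderiv_X_of_ne (by simp), smul_zero,
        _root_.add_zero, mul_smul_comm]

end HasSymbol

/-! ### Matrix elements of the primary field -/

lemma primary_tmul (b α P' P : ℂ) (f g : Fock) (v w : Verma) :
    primary b α P' P (f ⊗ₜ v) (g ⊗ₜ w) = heisVertex (bgCharge b) α f g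
      * virVertex (centralCharge b) (dimP b P) (dimP b P') (dimV b α) v w := by
  simp [primary]

lemma bilin_ext {F G : State →ₗ[ℂ] OutState}
    (h : ∀ f v g w, F (f ⊗ₜ v) (g ⊗ₜ w) = G (f ⊗ₜ v) (g ⊗ₜ w)) (y u : State) : F y u = G y u := by
  have e : F = G := TensorProduct.ext' fun f v => TensorProduct.ext' fun g w => h f v g w
  rw [e]

lemma primary_opA_pos (b α P' P : ℂ) (k : ℕ) (y u : State) :
    primary b α P' P (opA ((k : ℤ) + 1) y) u = primary b α P' P y (raiseA k u)
      - Complex.I * (bgCharge b - α) * primary b α P' P y u := by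
  refine bilin_ext (F := primary b α P' P ∘ₗ opA ((k : ℤ) + 1))
    (G := (raiseA k).dualMap ∘ₗ primary b α P' P
      - (Complex.I * (bgCharge b - α)) • primary b α P' P) (fun f v g w => ?_) y u
  have e := LinearMap.congr_fun (heisVertex_comm_pos (bgCharge b) α
    (n := (k : ℤ) + 1) (by omega) f) g
  simp only [heisOut, LinearMap.sub_apply, LinearMap.smul_apply, smul_eq_mul,
    LinearMap.dualMap_apply] at e
  have hk : -((k : ℤ) + 1) = Int.negSucc k := by omega
  rw [hk] at e
  simp only [LinearMap.comp_apply, LinearMap.sub_apply, LinearMap.smul_apply, smul_eq_mul,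
    LinearMap.dualMap_apply, raiseA, opA_tmul, primary_tmul]
  linear_combination -(virVertex (centralCharge b) (dimP b P) (dimP b P') (dimV b α) v w) * e

lemma primary_raiseA (b α P' P : ℂ) (k : ℕ) (y u : State) :
    primary b α P' P (raiseA k y) u = primary b α P' P y (opA ((k : ℤ) + 1) u)
      + Complex.I * α * primary b α P' P y u := by
  refine bilin_ext (F := primary b α P' P ∘ₗ raiseA k)
    (G := (opA ((k : ℤ) + 1)).dualMap ∘ₗ primary b α P' P
      + (Complex.I * α) • primary b α P' P) (fun f v g w => ?_) y u
  have e := LinearMap.congr_fun (heisVertex_comm_neg (bgCharge b) α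
    (n := Int.negSucc k) (by omega) f) g
  simp only [heisOut, LinearMap.sub_apply, LinearMap.smul_apply, smul_eq_mul,
    LinearMap.dualMap_apply] at e
  have hk : -Int.negSucc k = (k : ℤ) + 1 := by omega
  rw [hk] at e
  simp only [LinearMap.comp_apply, LinearMap.add_apply, LinearMap.smul_apply, smul_eq_mul,
    LinearMap.dualMap_apply, raiseA, opA_tmul, primary_tmul]
  linear_combination -(virVertex (centralCharge b) (dimP b P) (dimP b P') (dimV b α) v w) * e

/-- The derivative in the primary field relation is eliminated by subtracting its $L_0$ case. For
this reason $L_n$ only enters later in the combination $L_n-L_0$. -/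
lemma primary_opL (b α P' P : ℂ) (n : ℤ) (y u : State) :
    primary b α P' P (opL b P n y) u = primary b α P' P (opL b P 0 y) u
      + primary b α P' P y (opL b P' (-n) u) - primary b α P' P y (opL b P' 0 u)
      - n * dimV b α * primary b α P' P y u := by
  refine bilin_ext (F := primary b α P' P ∘ₗ opL b P n)
    (G := primary b α P' P ∘ₗ opL b P 0 + (opL b P' (-n)).dualMap ∘ₗ primary b α P' P
      - (opL b P' 0).dualMap ∘ₗ primary b α P' P
      - ((n : ℂ) * dimV b α) • primary b α P' P) (fun f v g w => ?_) y u
  have e := LinearMap.congr_fun (virVertex_comm_aux (centralCharge b) (dimP b P) (dimP b P')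
    (dimV b α) n v) w
  simp only [virOut, LinearMap.sub_apply, LinearMap.add_apply, LinearMap.smul_apply, smul_eq_mul,
    LinearMap.dualMap_apply, neg_zero] at e
  simp only [LinearMap.comp_apply, LinearMap.add_apply, LinearMap.sub_apply,
    LinearMap.smul_apply, smul_eq_mul, LinearMap.dualMap_apply, opL_tmul, primary_tmul]
  linear_combination -(heisVertex (bgCharge b) α f g) * e

/-! ### Leading behaviour of matrix elements -/

open Filter Topology in
/-- If `α` and `P'` grow linearly in `t`, the matrix element between vacua of a state with symbol
`p` in degree `e` grows as `t ^ e`, with coefficient given by evaluating `p`. -/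
lemma HasSymbol.tendsto (b P α P' : ℂ) {e : ℤ} {y : State} {p : SymbolRing}
    (h : HasSymbol e y p) :
    Tendsto (fun t : ℕ => primary b (t * α) (t * P') P y VirHeis.vac * (t : ℂ) ^ (-e)) atTop
      (𝓝 (MvPolynomial.eval (symPoint α P') p)) := by
  have hinv : Tendsto (fun t : ℕ => ((t : ℂ))⁻¹) atTop (𝓝 0) :=
    tendsto_inv_atTop_nhds_zero_nat
  have hne : ∀ᶠ t : ℕ in atTop, (t : ℂ) ≠ 0 := by
    filter_upwards [eventually_ge_atTop 1] with t ht
    exact_mod_cast (by omega : t ≠ 0)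
  -- Structural induction alone fails at $L_{-(k+1)}y$, which requires the statement for $L_0y$, not
  -- a subterm of the derivation. Its degree is that of $y$, two less than the current one, so an
  -- outer induction on the degree suffices.
  suffices ∀ n : ℕ, ∀ (e : ℤ) (y : State) (p : SymbolRing), HasSymbol e y p → e < n →
      Tendsto (fun t : ℕ => primary b (t * α) (t * P') P y VirHeis.vac * (t : ℂ) ^ (-e)) atTop
        (𝓝 (MvPolynomial.eval (symPoint α P') p)) from
    this (e + 1).toNat e y p h (by omega)
  intro n
  induction n with
  | zero =>
    intro e y p h he
    obtain ⟨rfl, rfl⟩ := h.eq_zero_of_neg (by exact_mod_cast he)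
    simp
  | succ n ih =>
    intro e y p h he
    push_cast at he
    induction h with
    | vac => simp [primary_vac]
    | zero e => simp
    | add _ _ ih1 ih2 =>
      rw [map_add]
      refine ((ih1 he).add (ih2 he)).congr fun t => ?_
      rw [map_add, LinearMap.add_apply, add_mul]
    | smul r _ ih1 =>
      rw [MvPolynomial.smul_eval]
      refine ((ih1 he).const_mul r).congr fun t => ?_
      rw [map_smul, LinearMap.smul_apply, smul_eq_mul, mul_assoc]
    | @lower e y p hy _ =>
      have h1 := (ih e y p hy (by omega)).mul hinv
      rw [mul_zero] at h1
      rw [map_zero]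
      refine h1.congr' ?_
      filter_upwards [hne] with t ht
      rw [neg_add, zpow_add₀ ht, zpow_neg_one, mul_assoc]
    | @raiseA e y p k hy _ =>
      have h1 := (ih e y p hy (by omega)).const_mul (Complex.I * α)
      rw [map_mul, MvPolynomial.eval_X]
      refine h1.congr' ?_
      filter_upwards [hne] with t ht
      rw [primary_raiseA, opA_pos_vac, map_zero, zero_add, neg_add, zpow_add₀ ht, zpow_neg_one]
      field_simp
    | @raiseL e y p k hy _ =>
      have h1 := ih e y p hy (by omega)
      -- $L_0y$ has only degree `e`, so normalisation by degree `e + 2` makes its contribution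
      -- vanish.
      have h2 := ((ih e _ _ (hy.opL b P 0) (by omega)).mul hinv).mul hinv
      -- This is $t^{-2}\bigl((k+1)\Delta(t\alpha)-\Delta(tP')\bigr)$ expanded, where the first
      -- $\Delta$ is the dimension of $V_{t\alpha}$ and the second that of the momentum $tP'$.
      have h3 : Tendsto (fun t : ℕ => P' ^ 2 - ((k : ℂ) + 1) * α ^ 2
          + ((k + 1) * bgCharge b * α) * (t : ℂ)⁻¹
          - (bgCharge b ^ 2 / 4) * ((t : ℂ)⁻¹ * (t : ℂ)⁻¹)) atTop
          (𝓝 (P' ^ 2 - ((k : ℂ) + 1) * α ^ 2 + ((k + 1) * bgCharge b * α) * 0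
            - (bgCharge b ^ 2 / 4) * (0 * 0))) :=
        (tendsto_const_nhds.add (hinv.const_mul _)).sub ((hinv.mul hinv).const_mul _)
      have h4 := (h3.mul h1).add h2
      have hlim : (P' ^ 2 - ((k : ℂ) + 1) * α ^ 2 + ((k + 1) * bgCharge b * α) * 0
            - (bgCharge b ^ 2 / 4) * (0 * 0)) * MvPolynomial.eval (symPoint α P') p
          + MvPolynomial.eval (symPoint α P') (symL 0 p + (if (0 : ℕ) = 0 then dimP b P else 0) • p)
            * 0 * 0 = MvPolynomial.eval (symPoint α P') (MvPolynomial.X (Sum.inr k) * p) := by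
        rw [map_mul, MvPolynomial.eval_X]
        simp only [symPoint, Sum.elim_inr]
        ring
      rw [hlim] at h4
      refine h4.congr' ?_
      filter_upwards [hne] with t ht
      have e1 : -Int.negSucc k = (k : ℤ) + 1 := by omega
      rw [← opL_negSucc b P, primary_opL b _ _ _ (Int.negSucc k), e1, opL_pos_vac, opL_zero_vac, map_zero, map_smul,
        smul_eq_mul, neg_add, zpow_add₀ ht, Int.cast_negSucc, Nat.cast_zero]
      have e2 : (t : ℂ) ^ (-2 : ℤ) = (t : ℂ)⁻¹ * (t : ℂ)⁻¹ := by
        rw [← zpow_neg_one, ← zpow_add₀ ht]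
        norm_num
      rw [e2]
      simp only [dimP, dimV]
      push_cast
      field_simp
      ring

/-! ### Null states -/

/-- The monomial `∏ a_{-(k+1)}` over a list. -/
def fockMonomial (l : List ℕ) : Fock := (l.map fun k => MvPolynomial.X k).prod

/-- The monomial `∏ L_{-(k+1)}` over a list. -/
def vermaMonomial (l : List ℕ) : Verma := (l.map low).prod

/-- The level of a monomial. -/
def listLevel (l : List ℕ) : ℕ := (l.map (· + 1)).sum

/-- The state `∏ a_{-(k+1)} ∏ L_{-(k+1)} |P⟩`. -/
def stateMonomial (l₁ l₂ : List ℕ) : State := fockMonomial l₁ ⊗ₜ vermaMonomial l₂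

lemma raiseA_stateMonomial (k : ℕ) (l₁ l₂ : List ℕ) :
    raiseA k (stateMonomial l₁ l₂) = stateMonomial (k :: l₁) l₂ := by
  simp [stateMonomial, raiseA_tmul, fockMonomial]

lemma raiseL_stateMonomial (k : ℕ) (l₁ l₂ : List ℕ) :
    raiseL k (stateMonomial l₁ l₂) = stateMonomial l₁ (k :: l₂) := by
  simp [stateMonomial, raiseL_tmul, vermaMonomial]

lemma stateMonomial_nil : stateMonomial [] [] = vac := by
  simp [stateMonomial, vac, fockMonomial, vermaMonomial]

lemma listLevel_cons (k : ℕ) (l : List ℕ) : listLevel (k :: l) = k + 1 + listLevel l := by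
  simp [listLevel]

lemma virL_zero_vermaMonomial (c h : ℂ) (l : List ℕ) :
    virL c h 0 (vermaMonomial l) = (h + listLevel l) • vermaMonomial l := by
  induction l with
  | nil =>
    have e : vermaMonomial [] = 1 := by simp [vermaMonomial]
    rw [e, virL_one]
    simp [vacL, listLevel]
  | cons k l ih =>
    have e : vermaMonomial (k :: l) = low k * vermaMonomial l := by simp [vermaMonomial]
    have e1 : (0 : ℤ) - k - 1 = Int.negSucc k := by omega
    have e2 : central c 0 (-((k : ℤ) + 1)) = 0 := by
      unfold central
      rw [if_neg (by omega)]
    rw [e, virL_low_mul, ih, e1, virL_negSucc, e2, listLevel_cons, mul_smul_comm]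
    push_cast
    module

lemma opL_zero_stateMonomial (b P : ℂ) (l₁ l₂ : List ℕ) : opL b P 0 (stateMonomial l₁ l₂)
    = (dimP b P + listLevel l₂) • stateMonomial l₁ l₂ := by
  rw [stateMonomial, opL_tmul, virL_zero_vermaMonomial, TensorProduct.tmul_smul]

/-- The matrix elements of `V_α y` with all out-states of level less than `N` vanish. -/
def IsNull (b P : ℂ) (N : ℕ) (y : State) : Prop :=
  ∀ (P' α : ℂ) (l₁ l₂ : List ℕ), listLevel l₁ + listLevel l₂ < N →
    primary b α P' P y (stateMonomial l₁ l₂) = 0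

namespace IsNull

variable {b P : ℂ} {N : ℕ} {y : State}

lemma mono (h : IsNull b P N y) {M : ℕ} (hM : M ≤ N) : IsNull b P M y :=
  fun P' α l₁ l₂ hl => h P' α l₁ l₂ (hl.trans_le hM)

lemma add {y' : State} (h : IsNull b P N y) (h' : IsNull b P N y') : IsNull b P N (y + y') := by
  intro P' α l₁ l₂ hl
  rw [map_add, LinearMap.add_apply, h P' α l₁ l₂ hl, h' P' α l₁ l₂ hl, add_zero]

lemma smul (h : IsNull b P N y) (r : ℂ) : IsNull b P N (r • y) := by
  intro P' α l₁ l₂ hl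
  rw [map_smul, LinearMap.smul_apply, h P' α l₁ l₂ hl, smul_zero]

/-- Commuting $a_{k+1}$ through $V_\alpha$ turns it into $a_{-k-1}$ on the out-state, at the cost of
$k+1$ levels, plus a multiple of the original matrix element. -/
lemma opA (h : IsNull b P N y) (k : ℕ) : IsNull b P (N - (k + 1)) (opA ((k : ℤ) + 1) y) := by
  intro P' α l₁ l₂ hl
  rw [primary_opA_pos, raiseA_stateMonomial, h P' α _ _ (by rw [listLevel_cons]; omega),
    h P' α l₁ l₂ (by omega)]
  ring

/-- The difference acts on the out-state as $L_{-j}-L_0$ plus a scalar. The first term costs $j$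
levels; the others act on a monomial by scalars. -/
lemma opL_sub (h : IsNull b P N y) {j : ℕ} (hj : 0 < j) :
    IsNull b P (N - j) (opL b P j y - opL b P 0 y) := by
  intro P' α l₁ l₂ hl
  obtain ⟨k, rfl⟩ : ∃ k, j = k + 1 := ⟨j - 1, by omega⟩
  have e : -((k + 1 : ℕ) : ℤ) = Int.negSucc k := by omega
  rw [map_sub, LinearMap.sub_apply, primary_opL _ _ _ _ ((k + 1 : ℕ) : ℤ), e, opL_negSucc,
    raiseL_stateMonomial, opL_zero_stateMonomial, map_smul,
    h P' α l₁ l₂ (by omega), h P' α l₁ _ (by rw [listLevel_cons]; omega)]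
  simp

/-- The symbol of a null state of positive level vanishes. -/
lemma symbol_eq_zero {N : ℕ} (hN : 0 < N) {e : ℤ} {y : State} {p : SymbolRing}
    (hy : IsNull b P N y) (hs : HasSymbol e y p)
    (hp : p.IsWeightedHomogeneous varLevel N) : p = 0 := by
  induction N using Nat.strong_induction_on generalizing e y p with
  | _ N ih =>
    have h0 : ∀ α P' : ℂ, MvPolynomial.eval (symPoint α P') p = 0 := by
      intro α P'
      have h1 := hs.tendsto b P α P'
      have h2 : ∀ t : ℕ, primary b (t * α) (t * P') P y vac = 0 := by
        intro t
        have h3 := hy (t * P') (t * α) [] [] (by simpa [listLevel] using hN)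
        rwa [stateMonomial_nil] at h3
      simp only [h2, zero_mul] at h1
      exact tendsto_nhds_unique h1 tendsto_const_nhds
    -- The bound is strict because nullity up to level 0 is vacuous and says nothing about $a_N y$.
    have hA : ∀ k, k + 1 < N → Sum.inl k ∉ p.vars := by
      intro k hk
      have hw : (MvPolynomial.pderiv (Sum.inl k) p).IsWeightedHomogeneous varLevel
          (N - (k + 1)) := hp.pderiv (by simp only [varLevel, Sum.elim_inl]; omega)
      have h1 := ih (N - (k + 1)) (by omega) (by omega) (hy.opA k) (hs.opA k)
        (Submodule.smul_mem (MvPolynomial.weightedHomogeneousSubmodule ℂ varLevel _) _ hw)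
      refine notMem_vars_of_pderiv_eq_zero ((smul_eq_zero.mp h1).resolve_left ?_)
      exact div_ne_zero (Nat.cast_add_one_ne_zero k) two_ne_zero
    have hv := inl_notMem_vars hN hp hA h0
    refine eq_zero_of_symL_eq_zero hp hv (fun j hj hjN => ?_) h0
    -- Once the $a_{-k}$ are absent from `p`, the symbol of $L_0y$ is $(\Delta(P)+N)p$. Adding that
    -- multiple of `y` cancels it and leaves exactly `symL j p`. The state itself mixes levels, so
    -- the induction requires homogeneity of the symbol only.
    have hn : IsNull b P (N - j) (VirHeis.opL b P j y - VirHeis.opL b P 0 y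
        + (dimP b P + N) • y) := (hy.opL_sub hj).add ((hy.smul _).mono (Nat.sub_le _ _))
    have hsym := ((hs.opL b P j).sub (hs.opL b P 0)).add (hs.smul (dimP b P + N))
    have hL := symL_isWeightedHomogeneous hp (n' := N - j) (j := j) (by omega)
    refine ih (N - j) (by omega) (by omega) (e := e) hn ?_ hL
    rw [Nat.cast_zero] at hsym
    convert hsym using 1
    rw [symL_zero_apply hp hv, if_neg hj.ne', if_pos rfl]
    module

end IsNull

/-! ### Monomials indexed by Young diagrams -/

/-- The indices `k` of the factors `a_{-(k+1)}` or `L_{-(k+1)}` of the monomial of a Young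
diagram. -/
def diagramIndices (lam : YoungDiagram) : List ℕ := lam.rowLens.reverse.map Nat.pred

lemma sum_rowLens (lam : YoungDiagram) : lam.rowLens.sum = lam.card := by
  have h : ∀ c ∈ lam.cells, c.1 ∈ Finset.range (lam.colLen 0) := fun c hc =>
    Finset.mem_range.mpr (YoungDiagram.mem_iff_lt_colLen.mp
      (lam.up_left_mem le_rfl (Nat.zero_le c.2) hc))
  rw [YoungDiagram.card, Finset.card_eq_sum_card_fiberwise h]
  refine Eq.trans ?_ (Finset.sum_congr rfl fun i _ => lam.rowLen_eq_card)
  simp [YoungDiagram.rowLens, Finset.sum, Multiset.range]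

lemma listLevel_perm {l l' : List ℕ} (h : l.Perm l') : listLevel l = listLevel l' :=
  (h.map _).sum_eq

lemma map_succ_diagramIndices (lam : YoungDiagram) :
    (diagramIndices lam).map (· + 1) = lam.rowLens.reverse := by
  rw [diagramIndices, List.map_map]
  conv_rhs => rw [← List.map_id lam.rowLens.reverse]
  refine List.map_congr_left fun x hx => ?_
  have := lam.pos_of_mem_rowLens x (List.mem_reverse.mp hx)
  simp only [Function.comp_apply, id_eq]
  exact Nat.succ_pred_eq_of_pos this

lemma listLevel_diagramIndices (lam : YoungDiagram) :
    listLevel (diagramIndices lam) = lam.card := by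
  rw [listLevel, map_succ_diagramIndices, List.sum_reverse, sum_rowLens]

/-- Row lengths are sorted, so their multiset determines the diagram. -/
lemma diagram_ext {lam mu : YoungDiagram} (h : (diagramIndices lam).Perm (diagramIndices mu)) :
    lam = mu := by
  have h1 := h.map (· + 1)
  rw [map_succ_diagramIndices, map_succ_diagramIndices] at h1
  have h2 : lam.rowLens.Perm mu.rowLens :=
    (List.reverse_perm _).symm.trans (h1.trans (List.reverse_perm _))
  have h3 : lam.rowLens = mu.rowLens :=
    h2.eq_of_sortedGE lam.rowLens_sorted mu.rowLens_sorted
  exact YoungDiagram.equivListRowLens.injective (Subtype.ext h3)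

lemma exists_diagramIndices_perm (l : List ℕ) : ∃ lam, (diagramIndices lam).Perm l := by
  have hpos : ∀ x ∈ (l.map (· + 1)).insertionSort (· ≥ ·), 0 < x := by
    intro x hx
    rw [List.mem_insertionSort, List.mem_map] at hx
    obtain ⟨y, _, rfl⟩ := hx
    omega
  refine ⟨YoungDiagram.ofRowLens ((l.map (· + 1)).insertionSort (· ≥ ·))
    List.sortedGE_insertionSort, ?_⟩
  rw [diagramIndices, YoungDiagram.rowLens_ofRowLens_eq_self hpos]
  have h := ((List.reverse_perm _).trans
    (List.perm_insertionSort (· ≥ ·) (l.map (· + 1)))).map Nat.pred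
  simpa [List.map_map, Function.comp_def] using h

lemma prod_opA_stateMonomial (l : List ℕ) (hl : ∀ x ∈ l, 0 < x) (l₁ l₂ : List ℕ) :
    (l.map fun k : ℕ => opA (-(k : ℤ))).prod (stateMonomial l₁ l₂)
      = stateMonomial (l.map Nat.pred ++ l₁) l₂ := by
  induction l with
  | nil => simp
  | cons k l ih =>
    have hk := hl k (by simp)
    have e : -(k : ℤ) = Int.negSucc k.pred := by rw [Nat.pred_eq_sub_one]; omega
    rw [List.map_cons, List.prod_cons, Module.End.mul_apply,
      ih fun x hx => hl x (List.mem_cons_of_mem _ hx), e]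
    exact raiseA_stateMonomial _ _ _

lemma prod_opL_stateMonomial (b P : ℂ) (l : List ℕ) (hl : ∀ x ∈ l, 0 < x) (l₁ l₂ : List ℕ) :
    (l.map fun k : ℕ => opL b P (-(k : ℤ))).prod (stateMonomial l₁ l₂)
      = stateMonomial l₁ (l.map Nat.pred ++ l₂) := by
  induction l with
  | nil => simp
  | cons k l ih =>
    have hk := hl k (by simp)
    have e : -(k : ℤ) = Int.negSucc k.pred := by rw [Nat.pred_eq_sub_one]; omega
    rw [List.map_cons, List.prod_cons, Module.End.mul_apply,
      ih fun x hx => hl x (List.mem_cons_of_mem _ hx), e, opL_negSucc]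
    exact raiseL_stateMonomial _ _ _

lemma aNeg_lNeg_vac (b P : ℂ) (lam mu : YoungDiagram) :
    aNeg lam (lNeg b P mu vac) = stateMonomial (diagramIndices lam) (diagramIndices mu) := by
  have h : ∀ nu : YoungDiagram, ∀ x ∈ nu.rowLens.reverse, 0 < x := fun nu x hx =>
    nu.pos_of_mem_rowLens x (List.mem_reverse.mp hx)
  rw [aNeg, lNeg, ← stateMonomial_nil, prod_opL_stateMonomial b P _ (h mu),
    prod_opA_stateMonomial _ (h lam), List.append_nil, List.append_nil]
  rfl

/-- Transposition reverses products, which is how conjugation exchanges the orders of factors in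
`lPos` and `lNeg`, and in `aPos` and `aNeg`. -/
lemma prod_dualMap_apply {ι : Type} (T : ι → Module.End ℂ State) (l : List ι) (Φ : OutState)
    (u : State) : (l.map fun i => (T i).dualMap : List (Module.End ℂ OutState)).prod Φ u
      = Φ ((l.reverse.map T).prod u) := by
  induction l generalizing u with
  | nil => simp
  | cons i l ih =>
    rw [List.map_cons, List.prod_cons, Module.End.mul_apply, LinearMap.dualMap_apply, ih,
      List.reverse_cons, List.map_append, List.prod_append, Module.End.mul_apply]
    simp

lemma matrixElement_eq (b α P' P : ℂ) (mu₁ mu₂ : YoungDiagram) (Y : Element) :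
    matrixElement b α P' P mu₁ mu₂ Y = primary b α P' P (Y.op b P vac)
      (stateMonomial (diagramIndices mu₂) (diagramIndices mu₁)) := by
  rw [matrixElement, ← aNeg_lNeg_vac b P']
  refine (prod_dualMap_apply (fun k : ℕ => opL b P' (-(k : ℤ))) _ _ _).trans ?_
  exact prod_dualMap_apply (fun k : ℕ => opA (-(k : ℤ))) _ _ _

/-! ### Spanning by ordered monomials -/

/-- The span of the monomials of level `n` with less than `d` factors. -/
def shortSpan (d n : ℕ) : Submodule ℂ Verma :=
  Submodule.span ℂ {v | ∃ l : List ℕ, l.length < d ∧ listLevel l = n ∧ vermaMonomial l = v}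

lemma vermaMonomial_cons (k : ℕ) (l : List ℕ) :
    vermaMonomial (k :: l) = low k * vermaMonomial l := by
  simp [vermaMonomial]

lemma low_mul_mem_shortSpan (k : ℕ) {d n : ℕ} {v : Verma} (hv : v ∈ shortSpan d n) :
    low k * v ∈ shortSpan (d + 1) (k + 1 + n) := by
  refine Submodule.span_induction (p := fun v _ => low k * v ∈ shortSpan (d + 1) (k + 1 + n))
    ?_ ?_ ?_ ?_ hv
  · rintro _ ⟨l, hl, hn, rfl⟩
    refine Submodule.subset_span ⟨k :: l, by simpa using hl, ?_, vermaMonomial_cons k l⟩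
    rw [listLevel_cons, hn]
  · rw [mul_zero]
    exact Submodule.zero_mem _
  · intro x y _ _ hx hy
    rw [mul_add]
    exact Submodule.add_mem _ hx hy
  · intro r x _ hx
    rw [mul_smul_comm]
    exact Submodule.smul_mem _ _ hx

/-- The reordering step of Poincaré–Birkhoff–Witt: a transposition of neighbours costs a commutator,
which merges two factors into one of the same total level. -/
lemma vermaMonomial_sub_mem_of_perm {l l' : List ℕ} (h : l.Perm l') :
    vermaMonomial l - vermaMonomial l' ∈ shortSpan l.length (listLevel l) := by
  induction h with
  | nil => simp
  | cons k _ ih =>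
    rw [vermaMonomial_cons, vermaMonomial_cons, ← mul_sub, listLevel_cons]
    exact low_mul_mem_shortSpan k ih
  | swap j k l =>
    have e : vermaMonomial (k :: j :: l) - vermaMonomial (j :: k :: l)
        = ((j : ℂ) - k) • vermaMonomial ((k + j + 1) :: l) := by
      simp only [vermaMonomial_cons, ← mul_assoc]
      rw [low_mul_low k j, add_mul, smul_mul_assoc, add_sub_cancel_left]
    rw [e]
    refine Submodule.smul_mem _ _ (Submodule.subset_span ⟨_, by simp, ?_, rfl⟩)
    simp only [listLevel_cons]
    omega
  | trans h₁ _ ih₁ ih₂ =>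
    rw [← h₁.length_eq, ← listLevel_perm h₁] at ih₂
    have h := Submodule.add_mem _ ih₁ ih₂
    rwa [sub_add_sub_cancel] at h

/-- Monomials are combinations of the monomials of Young diagrams of the same level. -/
lemma vermaMonomial_mem_span (l : List ℕ) : vermaMonomial l ∈ Submodule.span ℂ
    {v | ∃ mu : YoungDiagram, mu.card = listLevel l ∧ vermaMonomial (diagramIndices mu) = v} := by
  induction hd : l.length using Nat.strong_induction_on generalizing l with
  | _ d ih =>
    obtain ⟨mu, hmu⟩ := exists_diagramIndices_perm l
    have h := vermaMonomial_sub_mem_of_perm hmu.symm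
    rw [← sub_add_cancel (vermaMonomial l) (vermaMonomial (diagramIndices mu))]
    refine Submodule.add_mem _ ?_ (Submodule.subset_span ⟨mu, ?_, rfl⟩)
    · refine (Submodule.span_le.mpr ?_) h
      rintro _ ⟨l', hl', hn, rfl⟩
      rw [← hn]
      exact ih l'.length (hd ▸ hl') l' rfl
    · rw [← listLevel_diagramIndices, listLevel_perm hmu]

lemma fockMonomial_perm {l l' : List ℕ} (h : l.Perm l') : fockMonomial l = fockMonomial l' :=
  (h.map _).prod_eq

/-- Passes from ordered to arbitrary words in the out-state. The induction requires this generality,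
since `IsNull.opL_sub` prepends a factor regardless of order. -/
lemma isNull_of_diagrams {b P : ℂ} {N : ℕ} {y : State}
    (h : ∀ (P' α : ℂ) (mu₁ mu₂ : YoungDiagram), mu₁.card + mu₂.card < N →
      primary b α P' P y (stateMonomial (diagramIndices mu₂) (diagramIndices mu₁)) = 0) :
    IsNull b P N y := by
  intro P' α l₁ l₂ hl
  obtain ⟨mu₂, hmu₂⟩ := exists_diagramIndices_perm l₁
  have hspan := vermaMonomial_mem_span l₂
  rw [stateMonomial, ← fockMonomial_perm hmu₂]
  have hker : Submodule.span ℂ {v | ∃ mu : YoungDiagram, mu.card = listLevel l₂ ∧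
      vermaMonomial (diagramIndices mu) = v} ≤ LinearMap.ker (primary b α P' P y ∘ₗ
        TensorProduct.mk ℂ Fock Verma (fockMonomial (diagramIndices mu₂))) := by
    refine Submodule.span_le.mpr ?_
    rintro _ ⟨mu₁, hmu₁, rfl⟩
    refine h P' α mu₁ mu₂ ?_
    rw [hmu₁, ← listLevel_diagramIndices mu₂, listLevel_perm hmu₂]
    omega
  exact hker hspan

/-! ### Symbols of monomials -/

/-- The exponents of the symbol of a monomial. -/
def symExponents (l₁ l₂ : List ℕ) : ℕ ⊕ ℕ →₀ ℕ :=
  (l₁.map fun k => Finsupp.single (Sum.inl k) 1).sum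
    + (l₂.map fun k => Finsupp.single (Sum.inr k) 1).sum

lemma sum_map_single_apply {ι : Type} {f : ℕ → ι} (hf : Function.Injective f) (l : List ℕ)
    (k : ℕ) : (l.map fun k => Finsupp.single (f k) 1).sum (f k) = l.count k := by
  induction l with
  | nil => simp
  | cons j l ih =>
    rw [List.map_cons, List.sum_cons, Finsupp.add_apply, ih, List.count_cons, add_comm]
    by_cases h : j = k
    · simp [h]
    · rw [Finsupp.single_eq_of_ne (fun h' => h (hf h').symm)]
      simp [h]

lemma sum_map_single_eq_zero {ι : Type} {f : ℕ → ι} {i : ι} (hi : ∀ k, i ≠ f k) (l : List ℕ) :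
    (l.map fun k => Finsupp.single (f k) 1).sum i = 0 := by
  induction l with
  | nil => simp
  | cons j l ih =>
    rw [List.map_cons, List.sum_cons, Finsupp.add_apply, ih, Finsupp.single_eq_of_ne (hi j)]

lemma symExponents_inl (l₁ l₂ : List ℕ) (k : ℕ) :
    symExponents l₁ l₂ (Sum.inl k) = l₁.count k := by
  rw [symExponents, Finsupp.add_apply, sum_map_single_apply Sum.inl_injective,
    sum_map_single_eq_zero (fun _ => Sum.inl_ne_inr), add_zero]

lemma symExponents_inr (l₁ l₂ : List ℕ) (k : ℕ) :
    symExponents l₁ l₂ (Sum.inr k) = l₂.count k := by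
  rw [symExponents, Finsupp.add_apply, sum_map_single_apply Sum.inr_injective,
    sum_map_single_eq_zero (fun _ => Sum.inr_ne_inl), zero_add]

lemma symExponents_diagram_injective {σ τ : YoungDiagram × YoungDiagram}
    (h : symExponents (diagramIndices σ.1) (diagramIndices σ.2)
      = symExponents (diagramIndices τ.1) (diagramIndices τ.2)) : σ = τ := by
  refine Prod.ext (diagram_ext ?_) (diagram_ext ?_)
  · refine List.perm_iff_count.mpr fun k => ?_
    rw [← symExponents_inl, h, symExponents_inl]
  · refine List.perm_iff_count.mpr fun k => ?_
    rw [← symExponents_inr, h, symExponents_inr]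

lemma weight_symExponents (l₁ l₂ : List ℕ) :
    Finsupp.weight varLevel (symExponents l₁ l₂) = listLevel l₁ + listLevel l₂ := by
  rw [symExponents, map_add, map_list_sum, map_list_sum, List.map_map, List.map_map]
  simp [Function.comp_def, Finsupp.weight_single, varLevel, listLevel]

lemma hasSymbol_stateMonomial (l₁ l₂ : List ℕ) :
    HasSymbol (l₁.length + 2 * l₂.length) (stateMonomial l₁ l₂)
      (MvPolynomial.monomial (symExponents l₁ l₂) 1) := by
  induction l₁ with
  | nil =>
    induction l₂ with
    | nil => simpa [symExponents, stateMonomial_nil] using HasSymbol.vac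
    | cons k l ih =>
      have h := ih.raiseL k
      rw [raiseL_stateMonomial, MvPolynomial.X, MvPolynomial.monomial_mul, one_mul] at h
      convert h using 1
      · simp
        ring
      · simp [symExponents]
  | cons k l ih =>
    have h := ih.raiseA k
    rw [raiseA_stateMonomial, MvPolynomial.X, MvPolynomial.monomial_mul, one_mul] at h
    convert h using 1
    · simp
      ring
    · simp [symExponents, add_assoc]

/-- An element of positive level whose image has vanishing matrix elements with all out-states of
smaller level is zero. -/
theorem eq_zero_of_isNull {b P : ℂ} {N : ℕ} (hN : 0 < N) {Y : Element} (hY : Y.IsLevel N)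
    (h : IsNull b P N (Y.op b P vac)) : Y = 0 := by
  by_contra hne
  let deg : YoungDiagram × YoungDiagram → ℤ := fun σ =>
    (diagramIndices σ.1).length + 2 * (diagramIndices σ.2).length
  let ex : YoungDiagram × YoungDiagram → (ℕ ⊕ ℕ →₀ ℕ) := fun σ =>
    symExponents (diagramIndices σ.1) (diagramIndices σ.2)
  -- With `τ` of maximal degree, all terms of smaller degree have symbol 0 in degree `deg τ`, while
  -- `τ` itself contributes a monomial that no other pair can cancel.
  obtain ⟨τ, hτ, hmax⟩ := Y.support.exists_max_image deg (Finsupp.support_nonempty_iff.mpr hne)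
  let p : SymbolRing := ∑ σ ∈ Y.support,
    if deg σ = deg τ then MvPolynomial.monomial (ex σ) (Y σ) else 0
  have hsym : HasSymbol (deg τ) (Y.op b P vac) p := by
    have e : Y.op b P vac = ∑ σ ∈ Y.support,
        Y σ • stateMonomial (diagramIndices σ.1) (diagramIndices σ.2) := by
      rw [Element.op, Finsupp.sum, LinearMap.sum_apply]
      refine Finset.sum_congr rfl fun σ _ => ?_
      rw [LinearMap.smul_apply, Module.End.mul_apply, aNeg_lNeg_vac]
    rw [e]
    refine HasSymbol.sum _ fun σ hσ => ?_
    have h1 := (hasSymbol_stateMonomial (diagramIndices σ.1) (diagramIndices σ.2)).smul (Y σ)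
    split_ifs with hd
    · rw [← hd]
      simpa [MvPolynomial.smul_monomial] using h1
    · exact h1.lower_of_lt (lt_of_le_of_ne (hmax σ hσ) hd)
  have hp : p.IsWeightedHomogeneous varLevel N := by
    refine Submodule.sum_mem (MvPolynomial.weightedHomogeneousSubmodule ℂ varLevel N)
      fun σ hσ => ?_
    split_ifs
    · refine MvPolynomial.isWeightedHomogeneous_monomial _ _ _ ?_
      rw [weight_symExponents, listLevel_diagramIndices, listLevel_diagramIndices]
      exact hY σ (Finsupp.mem_support_iff.mp hσ)
    · exact Submodule.zero_mem _
  have hcoeff : MvPolynomial.coeff (ex τ) p = Y τ := by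
    rw [MvPolynomial.coeff_sum, Finset.sum_eq_single_of_mem τ hτ]
    · rw [if_pos rfl, MvPolynomial.coeff_monomial, if_pos rfl]
    · intro σ _ hστ
      split_ifs
      · rw [MvPolynomial.coeff_monomial, if_neg]
        exact fun h2 => hστ (symExponents_diagram_injective h2)
      · simp
  rw [h.symbol_eq_zero hN hsym hp, MvPolynomial.coeff_zero] at hcoeff
  exact Finsupp.mem_support_iff.mp hτ hcoeff.symm

end VirHeis

end

theorem lemma1 (b : ℂ) (hb : b ≠ 0) (N : ℕ) (hN : 1 ≤ N) (P : ℂ) (Y : VirHeis.Element)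
    (hY : Y.IsLevel N)
    (hnull : ∀ (P' α : ℂ) (mu₁ mu₂ : YoungDiagram), mu₁.card + mu₂.card < N →
      VirHeis.matrixElement b α P' P mu₁ mu₂ Y = 0) :
    Y = 0 := by
  refine VirHeis.eq_zero_of_isNull (b := b) (P := P) hN hY (VirHeis.isNull_of_diagrams fun P' α mu₁ mu₂ hmu => ?_)
  rw [← VirHeis.matrixElement_eq]
  exact hnull P' α mu₁ mu₂ hmu
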